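/- Let $S$ be a closed surface (a compact Hausdorff $2$-manifold without boundary) and let $\phi\colon S\to\mathbb R^3$ be a general position immersion: $\phi$ is continuous; every $p\in\mathbb R^3$ has at most three preimages, and there are an open neighbourhood $W$ of $p$ and a homeomorphism $W\to\mathbb R^3$ taking $p$ to the origin such that $\phi^{-1}(W)$ is a disjoint union of open sets, one for each preimage of $p$, which $\phi$ embeds in $W$ and which the homeomorphism carries onto pairwise different coordinate planes of $\mathbb R^3$; and there are only finitely many triple points, i.e. points with exactly three preimages. Let $D_\phi\subseteq\mathbb R^3$ be the set of points with more than one preimage, and call $\phi^{-1}(D_\phi)\subseteq S$ the singular set. Let $C\subset S$ be an embedded simple closed curve that is orientation-preserving, i.e. that has an orientable tubular neighbourhood (an open annulus $S^1\times\mathbb R$ embedded in $S$ with core $S^1\times\{0\}=C$). Suppose that $C\cap\phi^{-1}(D_\phi)$ is finite, that $C$ meets the singular set transversally at each of these points (there are local coordinates of $S$ centred at the point in which $C$ and $\phi^{-1}(D_\phi)$ are the two coordinate axes of $\mathbb R^2$), and that $\phi(C)$ contains no triple point. Then \[\mathrm{card}\left(C\cap\phi^{-1}(D_\phi)\right)\]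 is even. -/

import Mathlib

namespace SurfaceImmersion

open Set Topology

/-- The Euclidean plane. -/
abbrev E2 : Type := EuclideanSpace ℝ (Fin 2)

/-- Euclidean three-space. -/
abbrev E3 : Type := EuclideanSpace ℝ (Fin 3)

variable {S : Type*} [TopologicalSpace S]

/-- The double set `D_φ`: the points whose preimage consists of more than one point. -/
def doubleSet (φ : S → E3) : Set E3 :=
  {p | 1 < (φ ⁻¹' {p}).encard}

/-- The singular set `φ⁻¹(D_φ)` in the surface. -/
def singularSet (φ : S → E3) : Set S :=
  φ ⁻¹' doubleSet φ

/-- The triple points: the points whose preimage consists of exactly three points. -/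
def triplePoints (φ : S → E3) : Set E3 :=
  {p | (φ ⁻¹' {p}).encard = 3}

/-- Near `p`, the map `φ` consists of `k ≤ 3` embedded sheets that lie in space, up to a local
homeomorphism `h` taking `p` to the origin, as `k` distinct coordinate planes do.
Since each of these planes contains the origin, `k` is the number of preimages of `p`:
`k = 0` off the image, `k = 1` means that `φ` is a (locally flat) embedding near `p`, `k = 2`
is a transversal double point, and `k = 3` is a triple point. -/
def IsNormalCrossingAt (φ : S → E3) (p : E3) : Prop :=
  ∃ (k : ℕ) (hk : k ≤ 3) (h : OpenPartialHomeomorph E3 E3) (U : Fin k → Set S),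
    p ∈ h.source ∧ h p = 0 ∧ h.target = univ ∧
    (∀ i, IsOpen (U i)) ∧ (∀ i j, i ≠ j → Disjoint (U i) (U j)) ∧
    φ ⁻¹' h.source = ⋃ i, U i ∧
    ∀ i, IsEmbedding (fun x : U i => φ x) ∧
      φ '' U i = {q ∈ h.source | h q (Fin.castLE hk i) = 0}

/-- General position immersions of a surface into three-space, in the topological category
(which contains both the smooth and the polyhedral ones). -/
structure IsGeneralPositionImmersion (φ : S → E3) : Prop where
  continuous : Continuous φ
  normalCrossing : ∀ p, IsNormalCrossingAt φ p
  finite_triplePoints : (triplePoints φ).Finite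

/-- The closed curve `γ` has an orientable tubular neighbourhood, that is, an open annulus
neighbourhood of which `γ` is the core. -/
def IsOrientationPreserving (γ : Circle → S) : Prop :=
  ∃ e : Circle × ℝ → S, IsOpenEmbedding e ∧ ∀ z, e (z, 0) = γ z

/-- The subsets `A` and `B` of a surface cross transversally at `x`: in suitable local coordinates
centred at `x` they are the two coordinate axes of the plane. -/
def CrossTransversallyAt (A B : Set S) (x : S) : Prop :=
  ∃ g : OpenPartialHomeomorph S E2,
    x ∈ g.source ∧ g x = 0 ∧ g.target = univ ∧
    (∀ y ∈ g.source, y ∈ A ↔ g y 0 = 0) ∧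
    (∀ y ∈ g.source, y ∈ B ↔ g y 1 = 0)

end SurfaceImmersion

/-! The complement of the image of `φ` in a large ball has a checkerboard colouring, in which the
colour changes across each sheet. At a point of the curve off the singular set, the orientation of
the annulus together with the direction towards the side coloured by `A` gives a local orientation
of space. In space, local orientations at different points can be compared. Between singular points
this orientation does not change along the curve. Where the curve crosses a double curve it passes
through the other sheet, so the two sides of its own sheet exchange colours and the orientation is
reversed. After one turn the annulus, its orientation and the colouring are all the same as at the
start, so the number of reversals is even.

Since nothing is smooth, a local orientation is represented by a homotopy class of maps from the
unit sphere to punctured space. `IsSidedGerm` describes the representatives, which extend the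
parametrized surface over a ball and send the upper half to the coloured side. The argument rests on
four facts. `colourable_ball` glues local colourings over boxes, and thereby replaces an appeal to
the simple connectedness of the ball. `IsNormalChart.eventually_colour` says that in a normal chart
a colouring must be the sign of the product of the sheet coordinates, up to a global sign.
`exists_germ_eventually` says that near each parameter the sided germ is locally constant once it is
reflected as often as the singular set has been crossed. `not_sphereHomotopic_of_injOn` says that
the germ of a local homeomorphism is not homotopic to its reflection. The last fact is reduced to
the identity of the sphere, where the integral of a Jacobian serves as a degree. -/

namespace SurfaceImmersion

/-! ### Integrals of Jacobian determinants -/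

open Set Filter Topology MeasureTheory
open scoped ContDiff

/-- The partial derivative of `f` in the direction of the `j`-th coordinate. -/
noncomputable def partialDeriv (j : Fin 3) (f : E3 → ℝ) (x : E3) : ℝ :=
  fderiv ℝ f x (EuclideanSpace.single j 1)

theorem contDiff_partialDeriv {f : E3 → ℝ} (hf : ContDiff ℝ ∞ f) (j : Fin 3) :
    ContDiff ℝ ∞ (partialDeriv j f) := by
  unfold partialDeriv
  exact (hf.fderiv_right (m := ∞) (by simp)).clm_apply contDiff_const

theorem partialDeriv_comm {f : E3 → ℝ} (hf : ContDiff ℝ ∞ f) (i j : Fin 3) (x : E3) :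
    partialDeriv i (partialDeriv j f) x = partialDeriv j (partialDeriv i f) x := by
  have hd : DifferentiableAt ℝ (fderiv ℝ f) x :=
    (hf.fderiv_right (m := ∞) (by simp)).differentiable (by simp) x
  have key : ∀ a b : Fin 3, partialDeriv a (partialDeriv b f) x =
      fderiv ℝ (fderiv ℝ f) x (EuclideanSpace.single a 1) (EuclideanSpace.single b 1) := by
    intro a b
    unfold partialDeriv
    rw [fderiv_clm_apply hd (differentiableAt_const _)]
    simp
  rw [key, key]
  exact (hf.contDiffAt.isSymmSndFDerivAt (by simpa using WithTop.coe_le_coe.mpr (le_top : (2 : ℕ∞) ≤ ⊤))) _ _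

theorem partialDeriv_mul {f g : E3 → ℝ} (hf : ContDiff ℝ ∞ f) (hg : ContDiff ℝ ∞ g)
    (j : Fin 3) (x : E3) :
    partialDeriv j (fun y => f y * g y) x = f x * partialDeriv j g x + g x * partialDeriv j f x := by
  unfold partialDeriv
  rw [fderiv_fun_mul (hf.differentiable (by simp) x) (hg.differentiable (by simp) x)]
  simp

theorem partialDeriv_sub {f g : E3 → ℝ} (hf : ContDiff ℝ ∞ f) (hg : ContDiff ℝ ∞ g)
    (j : Fin 3) (x : E3) :
    partialDeriv j (fun y => f y - g y) x = partialDeriv j f x - partialDeriv j g x := by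
  unfold partialDeriv
  rw [fderiv_fun_sub (hf.differentiable (by simp) x) (hg.differentiable (by simp) x)]
  simp

theorem hasCompactSupport_partialDeriv {f : E3 → ℝ} (hf : HasCompactSupport f) (j : Fin 3) :
    HasCompactSupport (partialDeriv j f) :=
  hf.fderiv_apply (𝕜 := ℝ) _

/-- Integration by parts: a compactly supported function pairs to zero with a divergence-free
vector field. -/
theorem integral_partialDeriv_mul_eq_zero {f : E3 → ℝ} (hf : ContDiff ℝ ∞ f)
    (hfc : HasCompactSupport f) {w : Fin 3 → E3 → ℝ} (hw : ∀ j, ContDiff ℝ ∞ (w j))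
    (hdiv : ∀ x, ∑ j, partialDeriv j (w j) x = 0) :
    ∫ x, ∑ j, partialDeriv j f x * w j x = 0 := by
  have i1 : ∀ j, Integrable (fun x => partialDeriv j f x * w j x) := fun j =>
    ((contDiff_partialDeriv hf j).continuous.mul (hw j).continuous).integrable_of_hasCompactSupport
      (hasCompactSupport_partialDeriv hfc j).mul_right
  have i2 : ∀ j, Integrable (fun x => f x * partialDeriv j (w j) x) := fun j =>
    (hf.continuous.mul (contDiff_partialDeriv (hw j) j).continuous).integrable_of_hasCompactSupport
      hfc.mul_right
  have i3 : ∀ j, Integrable (fun x => f x * w j x) := fun j =>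
    (hf.continuous.mul (hw j).continuous).integrable_of_hasCompactSupport hfc.mul_right
  have ibp : ∀ j, ∫ x, partialDeriv j f x * w j x = - ∫ x, f x * partialDeriv j (w j) x := by
    intro j
    have := integral_mul_fderiv_eq_neg_fderiv_mul_of_integrable (i1 j) (i2 j) (i3 j)
      (fun x _ => hf.differentiable (by simp) x) (fun x _ => (hw j).differentiable (by simp) x)
    simp only [partialDeriv]
    linarith
  rw [integral_finsetSum _ (fun j _ => i1 j)]
  simp_rw [ibp]
  rw [Finset.sum_neg_distrib, ← integral_finsetSum _ (fun j _ => i2 j)]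
  simp_rw [← Finset.mul_sum, hdiv]
  simp

/-- The Jacobian determinant of a self-map of space. -/
noncomputable def jacobian (K : E3 → E3) (x : E3) : ℝ := (fderiv ℝ K x).det

theorem jacobian_eq {K : E3 → E3} (hK : ContDiff ℝ ∞ K) (x : E3) :
    jacobian K x = Matrix.det (Matrix.of fun i j => partialDeriv j (fun y => K y i) x) := by
  unfold jacobian
  rw [ContinuousLinearMap.det,
    ← LinearMap.det_toMatrix (EuclideanSpace.basisFun (Fin 3) ℝ).toBasis]
  congr 1
  ext i j
  have hd : DifferentiableAt ℝ K x := hK.differentiable (by simp) x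
  have : fderiv ℝ (fun y => K y i) x = (EuclideanSpace.proj i : E3 →L[ℝ] ℝ).comp (fderiv ℝ K x) :=
    ((EuclideanSpace.proj i : E3 →L[ℝ] ℝ).hasFDerivAt.comp x hd.hasFDerivAt).fderiv
  simp [LinearMap.toMatrix_apply, partialDeriv, this]

theorem contDiff_coord {K : E3 → E3} (hK : ContDiff ℝ ∞ K) (i : Fin 3) :
    ContDiff ℝ ∞ (fun y => K y i) :=
  (EuclideanSpace.proj i : E3 →L[ℝ] ℝ).contDiff.comp hK

/-- Expanded along its first row, the determinant is the gradient of the first component paired with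
the cross product of the gradients of the other two. That cross product is divergence-free because
mixed partial derivatives commute. -/
theorem integral_jacobian_eq_zero {K : E3 → E3} (hK : ContDiff ℝ ∞ K)
    (hc : HasCompactSupport K) : ∫ x, jacobian K x = 0 := by
  set f : E3 → ℝ := fun y => K y 0 with hf
  set g : E3 → ℝ := fun y => K y 1 with hg
  set k : E3 → ℝ := fun y => K y 2 with hk
  have sf : ContDiff ℝ ∞ f := contDiff_coord hK 0
  have sg : ContDiff ℝ ∞ g := contDiff_coord hK 1
  have sk : ContDiff ℝ ∞ k := contDiff_coord hK 2
  have fc : HasCompactSupport f := by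
    refine hc.mono fun x hx => ?_
    intro h
    apply hx
    simp [hf, h]
  have dg := contDiff_partialDeriv sg
  have dk := contDiff_partialDeriv sk
  have := integral_partialDeriv_mul_eq_zero sf fc
    (w := ![fun x => partialDeriv 1 g x * partialDeriv 2 k x - partialDeriv 2 g x * partialDeriv 1 k x,
      fun x => partialDeriv 2 g x * partialDeriv 0 k x - partialDeriv 0 g x * partialDeriv 2 k x,
      fun x => partialDeriv 0 g x * partialDeriv 1 k x - partialDeriv 1 g x * partialDeriv 0 k x])
    (by
      intro j
      fin_cases j
      · exact ((dg 1).mul (dk 2)).sub ((dg 2).mul (dk 1))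
      · exact ((dg 2).mul (dk 0)).sub ((dg 0).mul (dk 2))
      · exact ((dg 0).mul (dk 1)).sub ((dg 1).mul (dk 0)))
    (by
      intro x
      have e : ∀ i a b c d : Fin 3, partialDeriv i
          (fun x => partialDeriv a g x * partialDeriv b k x - partialDeriv c g x * partialDeriv d k x) x
          = (partialDeriv a g x * partialDeriv i (partialDeriv b k) x +
            partialDeriv b k x * partialDeriv i (partialDeriv a g) x) -
            (partialDeriv c g x * partialDeriv i (partialDeriv d k) x +
            partialDeriv d k x * partialDeriv i (partialDeriv c g) x) := by
        intro i a b c d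
        rw [partialDeriv_sub ((dg a).mul (dk b)) ((dg c).mul (dk d)),
          partialDeriv_mul (dg a) (dk b), partialDeriv_mul (dg c) (dk d)]
      simp only [Fin.sum_univ_three, Matrix.cons_val_zero, Matrix.cons_val_one, Matrix.cons_val]
      rw [e, e, e, partialDeriv_comm sg 1 0, partialDeriv_comm sg 2 0, partialDeriv_comm sg 2 1,
        partialDeriv_comm sk 1 0, partialDeriv_comm sk 2 0, partialDeriv_comm sk 2 1]
      ring)
  rw [← this]
  congr 1
  ext x
  rw [jacobian_eq hK, Matrix.det_fin_three]
  simp only [Fin.sum_univ_three, Matrix.cons_val_zero, Matrix.cons_val_one, Matrix.cons_val,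
    Matrix.of_apply]
  ring

theorem jacobian_congr {K L : E3 → E3} {x : E3} (h : K =ᶠ[𝓝 x] L) : jacobian K x = jacobian L x := by
  unfold jacobian
  rw [h.fderiv_eq]

theorem continuous_jacobian {K : E3 → E3} (hK : ContDiff ℝ ∞ K) : Continuous (jacobian K) :=
  ContinuousLinearMap.continuous_det.comp (hK.continuous_fderiv (by simp))

/-- The integral of the Jacobian only depends on the map near infinity. -/
theorem integral_jacobian_sub_eq_zero {Φ Ψ : E3 → E3} (hΦ : ContDiff ℝ ∞ Φ) (hΨ : ContDiff ℝ ∞ Ψ)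
    {R : ℝ} (h : ∀ x, R ≤ ‖x‖ → Φ x = Ψ x) :
    ∫ x, (jacobian Φ x - jacobian Ψ x) = 0 := by
  -- Multiplying both maps by a cutoff leaves the difference of Jacobians unchanged: where `χ` is
  -- not known to be `1`, the two maps agree and both differences vanish.
  obtain ⟨χ, hχs, hχc, hχ1⟩ : ∃ χ : E3 → ℝ, ContDiff ℝ ∞ χ ∧ HasCompactSupport χ ∧
      ∀ x, ‖x‖ < |R| + 1 → χ x = 1 := by
    let b : ContDiffBump (0 : E3) := ⟨|R| + 1, |R| + 2, by positivity, by linarith⟩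
    refine ⟨b, b.contDiff, b.hasCompactSupport, fun x hx => b.one_of_mem_closedBall ?_⟩
    simpa using hx.le
  have sΦ : ContDiff ℝ ∞ (fun x => χ x • Φ x) := hχs.smul hΦ
  have sΨ : ContDiff ℝ ∞ (fun x => χ x • Ψ x) := hχs.smul hΨ
  have cΦ : HasCompactSupport (fun x => χ x • Φ x) := hχc.smul_right
  have cΨ : HasCompactSupport (fun x => χ x • Ψ x) := hχc.smul_right
  have e : ∀ x, jacobian Φ x - jacobian Ψ x =
      jacobian (fun x => χ x • Φ x) x - jacobian (fun x => χ x • Ψ x) x := by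
    intro x
    by_cases hx : ‖x‖ < |R| + 1
    · have hn : ∀ᶠ y in 𝓝 x, ‖y‖ < |R| + 1 :=
        continuous_norm.continuousAt.eventually_lt continuousAt_const hx
      rw [jacobian_congr (K := fun x => χ x • Φ x) (L := Φ),
        jacobian_congr (K := fun x => χ x • Ψ x) (L := Ψ)]
      · filter_upwards [hn] with y hy
        simp [hχ1 y hy]
      · filter_upwards [hn] with y hy
        simp [hχ1 y hy]
    · have hn : ∀ᶠ y in 𝓝 x, R < ‖y‖ := by
        refine continuousAt_const.eventually_lt continuous_norm.continuousAt ?_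
        have := le_abs_self R
        linarith [not_lt.mp hx]
      rw [jacobian_congr (K := fun x => χ x • Φ x) (L := fun x => χ x • Ψ x),
        jacobian_congr (K := Φ) (L := Ψ)]
      · simp
      · filter_upwards [hn] with y hy
        exact h y hy.le
      · filter_upwards [hn] with y hy
        rw [h y hy.le]
  have iΦ : Integrable (jacobian fun x => χ x • Φ x) := by
    refine (continuous_jacobian sΦ).integrable_of_hasCompactSupport ?_
    have := cΦ.fderiv (𝕜 := ℝ)
    refine this.mono' fun x hx => subset_tsupport _ ?_
    intro h0
    apply hx
    simp [jacobian, h0, ContinuousLinearMap.det]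
  have iΨ : Integrable (jacobian fun x => χ x • Ψ x) := by
    refine (continuous_jacobian sΨ).integrable_of_hasCompactSupport ?_
    have := cΨ.fderiv (𝕜 := ℝ)
    refine this.mono' fun x hx => subset_tsupport _ ?_
    intro h0
    apply hx
    simp [jacobian, h0, ContinuousLinearMap.det]
  simp_rw [e]
  rw [integral_sub iΦ iΨ, integral_jacobian_eq_zero sΦ cΦ, integral_jacobian_eq_zero sΨ cΨ, sub_zero]

end SurfaceImmersion

/-! ### The identity of the sphere is not homotopic to a reflection -/

namespace SurfaceImmersion

open Set Filter Topology MeasureTheory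
open scoped ContDiff

/-- The reflection of space in the plane of the first two coordinates. -/
noncomputable def reflect : E3 ≃ₗᵢ[ℝ] E3 :=
  LinearIsometryEquiv.piLpCongrRight 2
    fun i : Fin 3 => if i = 2 then LinearIsometryEquiv.neg ℝ else LinearIsometryEquiv.refl ℝ ℝ

@[simp] theorem reflect_zero (x : E3) : reflect x 0 = x 0 := by
  simp [reflect]

@[simp] theorem reflect_one (x : E3) : reflect x 1 = x 1 := by
  simp [reflect]

@[simp] theorem reflect_two (x : E3) : reflect x 2 = -x 2 := by
  simp [reflect]

@[simp] theorem reflect_reflect (x : E3) : reflect (reflect x) = x := by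
  ext i
  fin_cases i <;> simp

theorem det_reflect :
    (reflect.toContinuousLinearEquiv : E3 →L[ℝ] E3).det = -1 := by
  rw [ContinuousLinearMap.det,
    ← LinearMap.det_toMatrix (EuclideanSpace.basisFun (Fin 3) ℝ).toBasis, Matrix.det_fin_three]
  simp [LinearMap.toMatrix_apply]

theorem jacobian_comp {F G : E3 → E3} (hF : ContDiff ℝ ∞ F) (hG : ContDiff ℝ ∞ G) (x : E3) :
    jacobian (fun y => F (G y)) x = jacobian F (G x) * jacobian G x := by
  unfold jacobian
  have : fderiv ℝ (fun y => F (G y)) x = (fderiv ℝ F (G x)).comp (fderiv ℝ G x) :=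
    fderiv_comp x (hF.differentiable (by simp) _) (hG.differentiable (by simp) _)
  rw [this]
  simp only [ContinuousLinearMap.det]
  exact LinearMap.det_comp _ _

theorem jacobian_reflect (x : E3) : jacobian reflect x = -1 := by
  rw [← det_reflect, jacobian]
  congr 1
  exact (reflect.toContinuousLinearEquiv : E3 →L[ℝ] E3).fderiv

/-- The map of space that applies a smooth step function of width `δ` to each coordinate. -/
noncomputable def stepMap (δ : ℝ) (y : E3) : E3 :=
  WithLp.toLp 2 fun i => Real.smoothTransition (y i / δ + 1 / 2)

theorem contDiff_stepMap (δ : ℝ) : ContDiff ℝ ∞ (stepMap δ) := by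
  rw [contDiff_euclidean]
  intro i
  have : ContDiff ℝ ∞ fun y : E3 => y i / δ + 1 / 2 :=
    ((EuclideanSpace.proj i : E3 →L[ℝ] ℝ).contDiff.div_const δ).add contDiff_const
  exact Real.smoothTransition.contDiff.comp this

theorem jacobian_stepMap (δ : ℝ) (y : E3) :
    jacobian (stepMap δ) y = ∏ i, deriv (fun s => Real.smoothTransition (s / δ + 1 / 2)) (y i) := by
  have hd : ∀ s : ℝ, DifferentiableAt ℝ (fun s => Real.smoothTransition (s / δ + 1 / 2)) s := by
    intro s
    have h1 : ContDiff ℝ ∞ fun s : ℝ => s / δ + 1 / 2 := by fun_prop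
    exact (Real.smoothTransition.contDiff (n := ⊤).comp h1).differentiable (by simp) s
  have key : ∀ i j : Fin 3, partialDeriv j (fun y : E3 => stepMap δ y i) y =
      deriv (fun s => Real.smoothTransition (s / δ + 1 / 2)) (y i) *
        (EuclideanSpace.single j (1 : ℝ) : E3) i := by
    intro i j
    have h1 := ((hd (y i)).hasDerivAt.comp_hasFDerivAt y
      ((EuclideanSpace.proj i : E3 →L[ℝ] ℝ).hasFDerivAt (x := y)))
    have h2 : fderiv ℝ (fun y : E3 => stepMap δ y i) y = _ := h1.fderiv
    rw [partialDeriv, h2]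
    simp
  rw [jacobian_eq (contDiff_stepMap δ), Matrix.det_fin_three, Fin.prod_univ_three]
  simp only [Matrix.of_apply, key]
  simp

theorem jacobian_stepMap_nonneg {δ : ℝ} (hδ : 0 < δ) (y : E3) : 0 ≤ jacobian (stepMap δ) y := by
  rw [jacobian_stepMap]
  refine Finset.prod_nonneg fun i _ => Monotone.deriv_nonneg fun a b hab => ?_
  exact Real.smoothTransition.monotone (by gcongr)

/-- Each one-variable step is constant outside `[-δ/2, δ/2]`, and a point of norm greater than `δ`
has a coordinate outside that interval, since `3/4 < 1`. The Jacobian of the step map thus serves as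
a nonnegative bump density around the origin. -/
theorem jacobian_stepMap_eq_zero {δ : ℝ} (hδ : 0 < δ) {y : E3} (hy : δ < ‖y‖) :
    jacobian (stepMap δ) y = 0 := by
  obtain ⟨i, hi⟩ : ∃ i, δ / 2 < |y i| := by
    by_contra! h
    have h2 : ‖y‖ ^ 2 ≤ 3 * (δ / 2) ^ 2 := by
      rw [EuclideanSpace.norm_sq_eq, Fin.sum_univ_three]
      have : ∀ i, ‖y i‖ ^ 2 ≤ (δ / 2) ^ 2 := fun i => by
        rw [Real.norm_eq_abs]
        exact pow_le_pow_left₀ (abs_nonneg _) (h i) 2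
      linarith [this 0, this 1, this 2]
    nlinarith
  rw [jacobian_stepMap]
  refine Finset.prod_eq_zero (Finset.mem_univ i) ?_
  rcases lt_abs.mp hi with h | h
  · have : (fun s => Real.smoothTransition (s / δ + 1 / 2)) =ᶠ[𝓝 (y i)] fun _ => 1 := by
      filter_upwards [lt_mem_nhds h] with s hs
      apply Real.smoothTransition.one_of_one_le
      have : 1 / 2 ≤ s / δ := by
        rw [le_div_iff₀ hδ]; linarith
      linarith
    rw [this.deriv_eq]
    simp
  · have : (fun s => Real.smoothTransition (s / δ + 1 / 2)) =ᶠ[𝓝 (y i)] fun _ => 0 := by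
      filter_upwards [gt_mem_nhds (show y i < -(δ / 2) by linarith)] with s hs
      apply Real.smoothTransition.zero_of_nonpos
      have : s / δ ≤ -(1 / 2) := by
        rw [div_le_iff₀ hδ]; linarith
      linarith
    rw [this.deriv_eq]
    simp

theorem hasCompactSupport_jacobian_stepMap {δ : ℝ} (hδ : 0 < δ) :
    HasCompactSupport (jacobian (stepMap δ)) := by
  refine HasCompactSupport.of_support_subset_isCompact (isCompact_closedBall (0 : E3) δ) ?_
  intro y hy
  by_contra h
  exact hy (jacobian_stepMap_eq_zero hδ (by simpa using h))

theorem integral_jacobian_stepMap_pos {δ : ℝ} (hδ : 0 < δ) :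
    0 < ∫ y, jacobian (stepMap δ) y := by
  obtain ⟨s, hs⟩ : ∃ s, deriv (fun s => Real.smoothTransition (s / δ + 1 / 2)) s ≠ 0 := by
    by_contra! h
    have h1 : ContDiff ℝ ∞ fun s : ℝ => s / δ + 1 / 2 := by fun_prop
    have hd := (Real.smoothTransition.contDiff (n := ⊤).comp h1).differentiable (by simp)
    have := is_const_of_deriv_eq_zero hd h (-δ) δ
    rw [Function.comp_apply, Function.comp_apply, Real.smoothTransition.zero_of_nonpos,
      Real.smoothTransition.one_of_one_le] at this
    · norm_num at this
    · rw [div_self hδ.ne']; norm_num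
    · rw [neg_div, div_self hδ.ne']; norm_num
  refine (continuous_jacobian (contDiff_stepMap δ)).integral_pos_of_hasCompactSupport_nonneg_nonzero
    (hasCompactSupport_jacobian_stepMap hδ) (jacobian_stepMap_nonneg hδ)
    (x := WithLp.toLp 2 fun _ => s) ?_
  rw [jacobian_stepMap]
  exact Finset.prod_ne_zero_iff.mpr fun i _ => hs

/-- There is no continuous self-map of space, zero only at the origin, that is the identity near
the origin and the reflection near infinity. -/
theorem not_exists_identity_reflect {G : E3 → E3} (hG : Continuous G) (h0 : ∀ x, x ≠ 0 → G x ≠ 0)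
    (hid : ∀ x, ‖x‖ < 1 → G x = x) (hre : ∀ x, 2 < ‖x‖ → G x = reflect x) : False := by
  obtain ⟨m, hm, hmG⟩ : ∃ m > 0, ∀ x : E3, 1 / 2 ≤ ‖x‖ → m ≤ ‖G x‖ := by
    have hc : IsCompact {x : E3 | 1 / 2 ≤ ‖x‖ ∧ ‖x‖ ≤ 3} := by
      refine (isCompact_closedBall (0 : E3) 3).of_isClosed_subset ?_ fun x hx => by simpa using hx.2
      exact (isClosed_le continuous_const continuous_norm).inter
        (isClosed_le continuous_norm continuous_const)
    have hne : {x : E3 | 1 / 2 ≤ ‖x‖ ∧ ‖x‖ ≤ 3}.Nonempty :=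
      ⟨EuclideanSpace.single 0 1, by norm_num, by norm_num⟩
    obtain ⟨x₀, hx₀, hmin⟩ := hc.exists_isMinOn hne hG.norm.continuousOn
    have hx0 : x₀ ≠ 0 := by
      rintro rfl
      have := hx₀.1
      norm_num at this
    refine ⟨min ‖G x₀‖ 1, lt_min (norm_pos_iff.mpr (h0 _ hx0)) one_pos, fun x hx => ?_⟩
    by_cases h3 : ‖x‖ ≤ 3
    · exact (min_le_left _ _).trans (hmin ⟨hx, h3⟩)
    · rw [hre x (by linarith), LinearIsometryEquiv.norm_map]
      exact (min_le_right _ _).trans (by linarith)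
  -- A smooth map within `δ` of `G` still has norm greater than `δ` wherever `1/2 ≤ ‖x‖`, so the
  -- bump density pulled back along it vanishes there.
  set δ : ℝ := min (m / 2) (1 / 4) with hδdef
  have hδ : 0 < δ := by positivity
  have hδm : 2 * δ ≤ m := by linarith [min_le_left (m / 2) (1 / 4 : ℝ)]
  have hδ4 : δ ≤ 1 / 4 := min_le_right _ _
  obtain ⟨P, hPs, hPd, hPe, -⟩ := hG.exists_contDiff_approx_and_eqOn (⊤ : ℕ∞)
    (ε := fun _ => δ) continuous_const (fun _ => hδ)
    (S := {x | ‖x‖ ≤ 9 / 10} ∪ {x | 21 / 10 ≤ ‖x‖}) (U := {x | ‖x‖ < 1} ∪ {x | 2 < ‖x‖})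
    ((isClosed_le continuous_norm continuous_const).union
      (isClosed_le continuous_const continuous_norm))
    (IsOpen.mem_nhdsSet ((isOpen_lt continuous_norm continuous_const).union
        (isOpen_lt continuous_const continuous_norm)) |>.mpr
      (union_subset_union (fun x hx => by simp only [mem_ofPred_eq] at hx ⊢; linarith)
        (fun x hx => by simp only [mem_ofPred_eq] at hx ⊢; linarith)))
    (by
      rintro x (hx | hx)
      · refine (contDiffAt_id.congr_of_eventuallyEq ?_).contDiffWithinAt
        filter_upwards [continuous_norm.continuousAt.eventually_lt continuousAt_const hx] with y hy
        exact hid y hy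
      · refine (reflect.contDiff.contDiffAt.congr_of_eventuallyEq ?_).contDiffWithinAt
        filter_upwards [continuousAt_const.eventually_lt continuous_norm.continuousAt hx] with y hy
        exact hre y hy)
  have hPbig : ∀ x : E3, 1 / 2 ≤ ‖x‖ → δ < ‖P x‖ := by
    intro x hx
    have h1 := hmG x hx
    have h2 := hPd x
    rw [dist_eq_norm, norm_sub_rev] at h2
    have h3 := norm_sub_norm_le (G x) (P x)
    linarith
  have sθ := contDiff_stepMap δ
  -- The pullback along `P` only sees the zone where `P` is the identity, while near infinity `P` is
  -- the reflection. Comparing the two integrals shows that the mass of the bump equals its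
  -- negative.
  have e1 : ∀ x, jacobian (fun y => stepMap δ (P y)) x = jacobian (stepMap δ) x := by
    intro x
    by_cases hx : ‖x‖ < 9 / 10
    · apply jacobian_congr
      filter_upwards [continuous_norm.continuousAt.eventually_lt continuousAt_const hx] with y hy
      rw [hPe (Or.inl hy.le), hid y (hy.trans (by norm_num))]
    · rw [jacobian_comp sθ hPs, jacobian_stepMap_eq_zero hδ (hPbig x (by linarith)),
        jacobian_stepMap_eq_zero hδ (by linarith), zero_mul]
  have e2 : ∀ x, jacobian (fun y => stepMap δ (reflect y)) x = - jacobian (stepMap δ) (reflect x) := by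
    intro x
    rw [jacobian_comp sθ reflect.contDiff, jacobian_reflect]
    ring
  have key := integral_jacobian_sub_eq_zero (sθ.comp hPs) (sθ.comp reflect.contDiff) (R := 21 / 10)
    (fun x hx => by
      simp only [Function.comp_apply]
      rw [hPe (Or.inr hx), hre x (by linarith)])
  have e1' : ∀ x, jacobian (stepMap δ ∘ P) x = jacobian (stepMap δ) x := e1
  have e2' : ∀ x, jacobian (stepMap δ ∘ reflect) x = - jacobian (stepMap δ) (reflect x) := e2
  simp_rw [e1', e2', sub_neg_eq_add] at key
  have hi : Integrable (jacobian (stepMap δ)) :=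
    (continuous_jacobian sθ).integrable_of_hasCompactSupport (hasCompactSupport_jacobian_stepMap hδ)
  have hmp : MeasurePreserving reflect volume volume := reflect.measurePreserving
  have hi' : Integrable (fun x => jacobian (stepMap δ) (reflect x)) :=
    hmp.integrable_comp_of_integrable hi
  rw [integral_add hi hi',
    hmp.integral_comp reflect.toHomeomorph.toMeasurableEquiv.measurableEmbedding] at key
  linarith [integral_jacobian_stepMap_pos hδ]

/-- Two maps from the unit sphere to punctured space are homotopic. -/
def SphereHomotopic (f g : Metric.sphere (0 : E3) 1 → E3) : Prop :=
  ∃ F G : C(Metric.sphere (0 : E3) 1, {x : E3 // x ≠ 0}),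
    (∀ x, (F x : E3) = f x) ∧ (∀ x, (G x : E3) = g x) ∧ F.Homotopic G

theorem SphereHomotopic.symm {f g : Metric.sphere (0 : E3) 1 → E3} (h : SphereHomotopic f g) :
    SphereHomotopic g f := by
  obtain ⟨F, G, hF, hG, H⟩ := h
  exact ⟨G, F, hG, hF, H.symm⟩

theorem SphereHomotopic.trans {f g k : Metric.sphere (0 : E3) 1 → E3} (h : SphereHomotopic f g)
    (h' : SphereHomotopic g k) : SphereHomotopic f k := by
  obtain ⟨F, G, hF, hG, H⟩ := h
  obtain ⟨G', K, hG', hK, H'⟩ := h'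
  have : G = G' := by
    ext1 x
    exact Subtype.ext ((hG x).trans (hG' x).symm)
  subst this
  exact ⟨F, K, hF, hK, H.trans H'⟩

/-- The reflection of the unit sphere in the plane of the first two coordinates. -/
noncomputable def sphereReflect (x : Metric.sphere (0 : E3) 1) : Metric.sphere (0 : E3) 1 :=
  ⟨reflect x, by simp⟩

theorem continuous_sphereReflect : Continuous sphereReflect :=
  (reflect.continuous.comp continuous_subtype_val).subtype_mk _

@[simp] theorem sphereReflect_sphereReflect (x : Metric.sphere (0 : E3) 1) :
    sphereReflect (sphereReflect x) = x :=
  Subtype.ext (reflect_reflect _)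

theorem SphereHomotopic.comp_reflect {f g : Metric.sphere (0 : E3) 1 → E3}
    (h : SphereHomotopic f g) :
    SphereHomotopic (f ∘ sphereReflect) (g ∘ sphereReflect) := by
  obtain ⟨F, G, hF, hG, H⟩ := h
  exact ⟨F.comp ⟨_, continuous_sphereReflect⟩, G.comp ⟨_, continuous_sphereReflect⟩,
    fun x => hF _, fun x => hG _, H.comp (ContinuousMap.Homotopic.refl _)⟩

theorem SphereHomotopic.exists_family {f g : Metric.sphere (0 : E3) 1 → E3}
    (h : SphereHomotopic f g) : ∃ K : unitInterval × Metric.sphere (0 : E3) 1 → E3,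
      Continuous K ∧ (∀ q, K q ≠ 0) ∧ (∀ x, K (0, x) = f x) ∧ ∀ x, K (1, x) = g x := by
  obtain ⟨F, G, hF, hG, ⟨H⟩⟩ := h
  refine ⟨fun q => (H q : E3), continuous_subtype_val.comp H.continuous, fun q => (H q).2,
    fun x => ?_, fun x => ?_⟩
  · simp [hF]
  · simp [hG]

/-- A homotopy can be spread radially over the shell `1 ≤ ‖x‖ ≤ 2`, with the identity inside and the
reflection outside. This gives a self-map of space excluded by `not_exists_identity_reflect`. -/
theorem not_sphereHomotopic_reflect :
    ¬ SphereHomotopic (fun x => (x : E3)) (fun x => (sphereReflect x : E3)) := by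
  intro h
  obtain ⟨K, hK, hK0, hKi, hKr⟩ := h.exists_family
  classical
  let G : E3 → E3 := fun x => if hx : x = 0 then 0 else
    ‖x‖ • K (projIcc 0 1 zero_le_one (‖x‖ - 1), ⟨‖x‖⁻¹ • x, by
      have := norm_ne_zero_iff.mpr hx
      simp [norm_smul, this]⟩)
  have hGne : ∀ x (hx : x ≠ 0), G x = ‖x‖ • K (projIcc 0 1 zero_le_one (‖x‖ - 1), ⟨‖x‖⁻¹ • x, by
      have := norm_ne_zero_iff.mpr hx
      simp [norm_smul, this]⟩) := fun x hx => dif_neg hx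
  have hid : ∀ x, ‖x‖ < 1 → G x = x := by
    intro x hx
    by_cases h0 : x = 0
    · simp [G, h0]
    · rw [hGne x h0, projIcc_of_le_left _ (by linarith)]
      have := hKi ⟨‖x‖⁻¹ • x, by
        have := norm_ne_zero_iff.mpr h0
        simp [norm_smul, this]⟩
      simp only [Icc.mk_zero] at this ⊢
      rw [this, smul_smul, mul_inv_cancel₀ (norm_ne_zero_iff.mpr h0), one_smul]
  refine not_exists_identity_reflect (G := G) ?_ ?_ hid ?_
  · rw [continuous_iff_continuousAt]
    intro x
    by_cases h0 : x = 0
    · have : G =ᶠ[𝓝 x] id := by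
        filter_upwards [continuous_norm.continuousAt.eventually_lt continuousAt_const
          (show ‖x‖ < 1 by simp [h0])] with y hy
        exact hid y hy
      exact continuousAt_id.congr this.symm
    · have hopen : IsOpen {y : E3 | y ≠ 0} := isOpen_ne
      refine ContinuousOn.continuousAt (s := {y : E3 | y ≠ 0}) ?_ (hopen.mem_nhds h0)
      rw [continuousOn_iff_continuous_domRestrict]
      have : {y : E3 | y ≠ 0}.domRestrict G = fun y : {y : E3 | y ≠ 0} => ‖(y : E3)‖ • K (projIcc 0 1 zero_le_one
          (‖(y : E3)‖ - 1), ⟨‖(y : E3)‖⁻¹ • (y : E3), by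
            have := norm_ne_zero_iff.mpr y.2
            simp [norm_smul, this]⟩) := by
        ext1 y
        exact hGne y y.2
      rw [this]
      refine continuous_subtype_val.norm.smul (hK.comp (Continuous.prodMk ?_ ?_))
      · exact continuous_projIcc.comp (continuous_subtype_val.norm.sub continuous_const)
      · refine Continuous.subtype_mk ?_ _
        exact (continuous_subtype_val.norm.inv₀ fun y => norm_ne_zero_iff.mpr y.2).smul
          continuous_subtype_val
  · intro x hx
    rw [hGne x hx]
    exact smul_ne_zero (norm_ne_zero_iff.mpr hx) (hK0 _)
  · intro x hx
    have h0 : x ≠ 0 := by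
      rintro rfl
      norm_num at hx
    rw [hGne x h0, projIcc_of_right_le _ (by linarith)]
    have := hKr ⟨‖x‖⁻¹ • x, by
        have := norm_ne_zero_iff.mpr h0
        simp [norm_smul, this]⟩
    simp only [Icc.mk_one] at this ⊢
    rw [this]
    simp only [sphereReflect, map_smul]
    rw [smul_smul, mul_inv_cancel₀ (norm_ne_zero_iff.mpr h0), one_smul]

end SurfaceImmersion

/-! ### Normal charts and the local structure of checkerboard colourings -/

namespace SurfaceImmersion

open Set Filter Topology

variable {S : Type*} [TopologicalSpace S]

/-- A local homeomorphism `h` of space in which the sheets `U i` of `φ` near `p` are coordinate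
planes. -/
structure IsNormalChart (φ : S → E3) (p : E3) {k : ℕ} (hk : k ≤ 3)
    (h : OpenPartialHomeomorph E3 E3) (U : Fin k → Set S) : Prop where
  mem_source : p ∈ h.source
  map_eq_zero : h p = 0
  target_eq : h.target = univ
  isOpen : ∀ i, IsOpen (U i)
  disjoint : ∀ i j, i ≠ j → Disjoint (U i) (U j)
  preimage_source : φ ⁻¹' h.source = ⋃ i, U i
  isEmbedding : ∀ i, IsEmbedding (fun x : U i => φ x)
  image_eq : ∀ i, φ '' U i = {q ∈ h.source | h q (Fin.castLE hk i) = 0}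

theorem IsNormalCrossingAt.exists_chart {φ : S → E3} {p : E3} (h : IsNormalCrossingAt φ p) :
    ∃ (k : ℕ) (hk : k ≤ 3) (h : OpenPartialHomeomorph E3 E3) (U : Fin k → Set S),
      IsNormalChart φ p hk h U := by
  obtain ⟨k, hk, h, U, h1, h2, h3, h4, h5, h6, h7⟩ := h
  exact ⟨k, hk, h, U, h1, h2, h3, h4, h5, h6, fun i => (h7 i).1, fun i => (h7 i).2⟩

/-- The product of the first `k` coordinates. -/
noncomputable def coordProd {k : ℕ} (hk : k ≤ 3) (y : E3) : ℝ :=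
  ∏ j : Fin k, y (Fin.castLE hk j)

theorem continuous_coord (i : Fin 3) : Continuous fun y : E3 => y i :=
  (EuclideanSpace.proj i : E3 →L[ℝ] ℝ).continuous

theorem continuous_coordProd {k : ℕ} (hk : k ≤ 3) : Continuous (coordProd hk) :=
  continuous_finsetProd _ fun _ _ => continuous_coord _

/-- The set `A` is one of the two colours of a checkerboard colouring, near `p`, of the complement
of the image of `φ`. -/
def IsColouringAt (φ : S → E3) (A : Set E3) (p : E3) : Prop :=
  (p ∉ range φ → A ∈ 𝓝 p ∨ Aᶜ ∈ 𝓝 p) ∧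
    ((φ ⁻¹' {p}).encard = 1 →
      (∃ᶠ q in 𝓝 p, q ∉ range φ ∧ q ∈ A) ∧ ∃ᶠ q in 𝓝 p, q ∉ range φ ∧ q ∉ A)

theorem IsColouringAt.compl {S : Type*} {φ : S → E3} {A : Set E3} {p : E3} (h : IsColouringAt φ A p) :
    IsColouringAt φ Aᶜ p := by
  refine ⟨fun hp => ?_, fun hp => ⟨(h.2 hp).2, ?_⟩⟩
  · rw [compl_compl]
    exact (h.1 hp).symm
  · simpa using (h.2 hp).1

/-- Only the colours of points off the image matter. Closedness of the image is what makes all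
points near an off-image point count. -/
theorem IsColouringAt.congr {S : Type*} {φ : S → E3} (hφ : IsClosed (range φ)) {A A' : Set E3} {p : E3}
    (h : IsColouringAt φ A p) (he : ∀ᶠ q in 𝓝 p, q ∉ range φ → (q ∈ A' ↔ q ∈ A)) :
    IsColouringAt φ A' p := by
  refine ⟨fun hp => ?_, fun hp => ⟨?_, ?_⟩⟩
  · have hn : ∀ᶠ q in 𝓝 p, q ∉ range φ := hφ.isOpen_compl.mem_nhds hp
    refine (h.1 hp).imp (fun hA => ?_) fun hA => ?_
    · filter_upwards [hn, he, hA] with q h1 h2 h3 using (h2 h1).mpr h3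
    · filter_upwards [hn, he, hA] with q h1 h2 h3 using fun h4 => h3 ((h2 h1).mp h4)
  · exact ((h.2 hp).1.and_eventually he).mono fun q hq => ⟨hq.1.1, (hq.2 hq.1.1).mpr hq.1.2⟩
  · exact ((h.2 hp).2.and_eventually he).mono fun q hq =>
      ⟨hq.1.1, fun h4 => hq.1.2 ((hq.2 hq.1.1).mp h4)⟩

namespace IsNormalChart

variable {φ : S → E3} {p : E3} {k : ℕ} {hk : k ≤ 3} {h : OpenPartialHomeomorph E3 E3}
  {U : Fin k → Set S}

theorem continuous_symm (H : IsNormalChart φ p hk h U) : Continuous h.symm := by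
  have := h.continuousOn_symm
  rwa [H.target_eq, continuousOn_univ] at this

theorem symm_mem (H : IsNormalChart φ p hk h U) (y : E3) : h.symm y ∈ h.source :=
  h.map_target (H.target_eq ▸ mem_univ y)

theorem apply_symm (H : IsNormalChart φ p hk h U) (y : E3) : h (h.symm y) = y :=
  h.right_inv (H.target_eq ▸ mem_univ y)

theorem symm_zero (H : IsNormalChart φ p hk h U) : h.symm 0 = p := by
  rw [← H.map_eq_zero, h.left_inv H.mem_source]

theorem injOn_sheet (H : IsNormalChart φ p hk h U) (i : Fin k) : InjOn φ (U i) :=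
  injOn_iff_injective.mpr (H.isEmbedding i).injective

theorem map_sheet (H : IsNormalChart φ p hk h U) {i : Fin k} {x : S} (hx : x ∈ U i) :
    φ x ∈ h.source ∧ h (φ x) (Fin.castLE hk i) = 0 := by
  have : φ x ∈ φ '' U i := mem_image_of_mem _ hx
  rw [H.image_eq] at this
  exact this

theorem exists_sheet (H : IsNormalChart φ p hk h U) {x : S} (hx : φ x ∈ h.source) : ∃ i, x ∈ U i := by
  have : x ∈ φ ⁻¹' h.source := hx
  rw [H.preimage_source] at this
  exact mem_iUnion.mp this

theorem exists_mem_sheet (H : IsNormalChart φ p hk h U) {q : E3} (hq : q ∈ h.source) {i : Fin k}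
    (hi : h q (Fin.castLE hk i) = 0) : ∃ x ∈ U i, φ x = q := by
  have : q ∈ φ '' U i := by
    rw [H.image_eq]
    exact ⟨hq, hi⟩
  exact this

/-- Each vanishing sheet coordinate accounts for exactly one preimage, on the corresponding sheet,
and disjoint sheets give different preimages. -/
theorem encard_preimage (H : IsNormalChart φ p hk h U) {q : E3} (hq : q ∈ h.source) :
    (φ ⁻¹' {q}).encard = {i : Fin k | h q (Fin.castLE hk i) = 0}.encard := by
  have key : ∀ i : {i : Fin k | h q (Fin.castLE hk i) = 0}, ∃ x ∈ U i, φ x = q :=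
    fun i => H.exists_mem_sheet hq i.2
  choose g hgU hgq using key
  have hinj : Function.Injective g := by
    intro i j hij
    by_contra hne
    exact disjoint_left.mp (H.disjoint i j fun h => hne (Subtype.ext h)) (hgU i) (hij ▸ hgU j)
  have himg : φ ⁻¹' {q} = range g := by
    ext x
    constructor
    · intro hx
      obtain ⟨i, hi⟩ := H.exists_sheet (x := x) (by rw [show φ x = q from hx]; exact hq)
      have h0 := (H.map_sheet hi).2
      rw [show φ x = q from hx] at h0
      exact ⟨⟨i, h0⟩, H.injOn_sheet i (hgU ⟨i, h0⟩) hi ((hgq _).trans (show φ x = q from hx).symm)⟩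
    · rintro ⟨i, rfl⟩
      exact hgq i
  rw [himg, ← image_univ, hinj.encard_image, encard_univ, ENat.card_coe_set_eq]

theorem mem_range_iff (H : IsNormalChart φ p hk h U) {q : E3} (hq : q ∈ h.source) : q ∈ range φ ↔ coordProd hk (h q) = 0 := by
  unfold coordProd
  rw [Finset.prod_eq_zero_iff]
  constructor
  · rintro ⟨x, rfl⟩
    obtain ⟨i, hi⟩ := H.exists_sheet hq
    exact ⟨i, Finset.mem_univ _, (H.map_sheet hi).2⟩
  · rintro ⟨i, -, hi⟩
    obtain ⟨x, -, hx⟩ := H.exists_mem_sheet hq hi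
    exact ⟨x, hx⟩

/-- The sign of the product of the coordinates is a checkerboard colouring. -/
theorem isColouringAt (H : IsNormalChart φ p hk h U) {q : E3} (hq : q ∈ h.source) :
    IsColouringAt φ {q | 0 < coordProd hk (h q)} q := by
  have hcont : ContinuousAt (fun q => coordProd hk (h q)) q :=
    (continuous_coordProd hk).continuousAt.comp (h.continuousAt hq)
  refine ⟨fun hr => ?_, fun h1 => ?_⟩
  · rw [H.mem_range_iff hq] at hr
    rcases lt_or_gt_of_ne hr with hr | hr
    · right
      filter_upwards [hcont.eventually_lt continuousAt_const hr] with q' h'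
      simpa using h'.le
    · left
      exact continuousAt_const.eventually_lt hcont hr
  · rw [H.encard_preimage hq, encard_eq_one] at h1
    obtain ⟨i, hi⟩ := h1
    -- Moving from `q` by `s` in the `i`-th chart direction makes the coordinate product `s * c`,
    -- which takes both signs.
    set c : ℝ := ∏ j ∈ Finset.univ.erase i, h q (Fin.castLE hk j) with hc
    have hc0 : c ≠ 0 := by
      rw [hc, Finset.prod_ne_zero_iff]
      intro j hj h0
      have : j ∈ ({i} : Set (Fin k)) := by
        rw [← hi]
        exact h0
      exact Finset.ne_of_mem_erase hj this
    have hprod : ∀ s : ℝ,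
        coordProd hk (h q + s • EuclideanSpace.single (Fin.castLE hk i) 1) = s * c := by
      intro s
      have hi0 : h q (Fin.castLE hk i) = 0 := by
        have : i ∈ {i : Fin k | h q (Fin.castLE hk i) = 0} := hi ▸ mem_singleton i
        exact this
      rw [coordProd, ← Finset.mul_prod_erase _ _ (Finset.mem_univ i)]
      congr 1
      · simp [hi0]
      · refine Finset.prod_congr rfl fun j hj => ?_
        have : Fin.castLE hk j ≠ Fin.castLE hk i := fun h =>
          Finset.ne_of_mem_erase hj (Fin.castLE_injective hk h)
        simp [this]
    have htend : Tendsto (fun s : ℝ => h.symm (h q + s • EuclideanSpace.single (Fin.castLE hk i) 1))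
        (𝓝 0) (𝓝 q) := by
      have : Continuous fun s : ℝ => h.symm (h q + s • EuclideanSpace.single (Fin.castLE hk i) 1) :=
        H.continuous_symm.comp (by fun_prop)
      have h2 := this.tendsto 0
      simpa [h.left_inv hq] using h2
    have hfreq : ∀ d : ℝ, d ≠ 0 → ∃ᶠ s in 𝓝 (0 : ℝ), 0 < s * d := by
      intro d hd
      rcases lt_or_gt_of_ne hd with hd | hd
      · exact (frequently_lt_nhds (0 : ℝ)).mono fun s hs => mul_pos_of_neg_of_neg hs hd
      · exact (frequently_gt_nhds (0 : ℝ)).mono fun s hs => mul_pos hs hd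
    constructor
    · refine htend.frequently ((hfreq c hc0).mono fun s hs => ?_)
      rw [H.mem_range_iff (H.symm_mem _), mem_ofPred_eq, H.apply_symm, hprod]
      exact ⟨hs.ne', hs⟩
    · refine htend.frequently ((hfreq (-c) (neg_ne_zero.mpr hc0)).mono fun s hs => ?_)
      rw [H.mem_range_iff (H.symm_mem _), mem_ofPred_eq, H.apply_symm, hprod]
      exact ⟨by intro h0; linarith, by linarith⟩

set_option maxHeartbeats 1000000 in
/-- Near `p`, every colouring is given by the sign of the product of the coordinates. -/
theorem eventually_colour (H : IsNormalChart φ p hk h U) {A : Set E3} (hA : ∀ᶠ q in 𝓝 p, IsColouringAt φ A q) :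
    ∃ σ : ℝ, (σ = 1 ∨ σ = -1) ∧
      ∀ᶠ q in 𝓝 p, q ∉ range φ → (q ∈ A ↔ 0 < σ * coordProd hk (h q)) := by
  classical
  obtain ⟨ε, hε, hball⟩ : ∃ ε > 0, ∀ y ∈ Metric.ball (0 : E3) ε, IsColouringAt φ A (h.symm y) := by
    have : ∀ᶠ y in 𝓝 (0 : E3), IsColouringAt φ A (h.symm y) := by
      refine H.continuous_symm.continuousAt.eventually ?_
      rwa [H.symm_zero]
    exact Metric.eventually_nhds_iff_ball.mp this
  -- `O s` is the part of the ball where exactly the sheet coordinates in `s` are negative. It is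
  -- convex and its preimage avoids the image of `φ`, so a colouring is constant on it; `a s` is its
  -- colour.
  let sg : Finset (Fin k) → Fin k → ℝ := fun s j => if j ∈ s then -1 else 1
  let O : Finset (Fin k) → Set E3 := fun s =>
    Metric.ball 0 ε ∩ ⋂ j, {y | 0 < sg s j * y (Fin.castLE hk j)}
  have hO : ∀ s y, y ∈ O s ↔ y ∈ Metric.ball (0 : E3) ε ∧ ∀ j, 0 < sg s j * y (Fin.castLE hk j) := by
    intro s y
    simp [O]
  have hOconn : ∀ s, IsPreconnected (O s) := by
    intro s
    refine ((convex_ball _ _).inter (convex_iInter fun j => ?_)).isPreconnected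
    exact (convex_Ioi (0 : ℝ)).linear_preimage
      ((sg s j • (EuclideanSpace.proj (Fin.castLE hk j) : E3 →L[ℝ] ℝ)).toLinearMap)
  have hOprod : ∀ s y, y ∈ O s → coordProd hk y ≠ 0 := by
    intro s y hy
    rw [coordProd, Finset.prod_ne_zero_iff]
    intro j _ h0
    have := ((hO s y).mp hy).2 j
    rw [h0] at this
    simp at this
  have hOconst : ∀ s y y', y ∈ O s → y' ∈ O s → (h.symm y ∈ A ↔ h.symm y' ∈ A) := by
    intro s y y' hy hy'
    refine (hOconn s).induction₂' (fun y y' => h.symm y ∈ A ↔ h.symm y' ∈ A) ?_ ?_ hy hy'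
    · intro z hz
      apply eventually_nhdsWithin_of_eventually_nhds
      have hz' : h.symm z ∉ range φ := by
        rw [H.mem_range_iff (H.symm_mem _), H.apply_symm]
        exact hOprod s z hz
      rcases (hball z ((hO s z).mp hz).1).1 hz' with hn | hn
      · have hzA := mem_of_mem_nhds hn
        filter_upwards [H.continuous_symm.continuousAt.preimage_mem_nhds hn] with w hw
        exact ⟨⟨fun _ => hw, fun _ => hzA⟩, ⟨fun _ => hzA, fun _ => hw⟩⟩
      · have hzA : h.symm z ∉ A := mem_of_mem_nhds hn
        filter_upwards [H.continuous_symm.continuousAt.preimage_mem_nhds hn] with w hw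
        have hw' : h.symm w ∉ A := hw
        simp [hzA, hw']
    · intro a b c _ _ _ h1 h2
      exact h1.trans h2
  have hsmall : ∀ v : E3, ∃ t : ℝ, 0 < t ∧ t • v ∈ Metric.ball (0 : E3) ε := by
    intro v
    refine ⟨ε / (2 * (‖v‖ + 1)), by positivity, ?_⟩
    rw [mem_ball_zero_iff, norm_smul, Real.norm_of_nonneg (by positivity), div_mul_eq_mul_div,
      div_lt_iff₀ (by positivity)]
    nlinarith [norm_nonneg v]
  let a : Finset (Fin k) → Prop := fun s => ∃ y ∈ O s, h.symm y ∈ A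
  have ha : ∀ s y, y ∈ O s → (h.symm y ∈ A ↔ a s) := by
    intro s y hy
    refine ⟨fun h1 => ⟨y, hy, h1⟩, ?_⟩
    rintro ⟨y', hy', h1⟩
    exact (hOconst s y y' hy hy').mpr h1
  clear_value a
  -- Take a point on the wall between two adjacent orthants and on no other wall. It has a single
  -- preimage, so both colours occur arbitrarily near it off the image, but only these two orthants
  -- are available there.
  have hflip : ∀ s i, i ∉ s → (a (insert i s) ↔ ¬ a s) := by
    intro s i his
    obtain ⟨t, ht, htb⟩ := hsmall (WithLp.toLp 2 fun l : Fin 3 =>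
      if l = Fin.castLE hk i then 0 else if ∃ j ∈ s, Fin.castLE hk j = l then -1 else 1)
    set y : E3 := t • (WithLp.toLp 2 fun l : Fin 3 =>
      if l = Fin.castLE hk i then 0 else if ∃ j ∈ s, Fin.castLE hk j = l then -1 else 1) with hy
    have hyi : y (Fin.castLE hk i) = 0 := by simp [hy]
    have hyj : ∀ j, j ≠ i → y (Fin.castLE hk j) = t * sg s j := by
      intro j hj
      have h1 : Fin.castLE hk j ≠ Fin.castLE hk i := fun h => hj (Fin.castLE_injective hk h)
      have h2 : (∃ j' ∈ s, Fin.castLE hk j' = Fin.castLE hk j) ↔ j ∈ s :=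
        ⟨fun ⟨j', h3, h4⟩ => Fin.castLE_injective hk h4 ▸ h3, fun h3 => ⟨j, h3, rfl⟩⟩
      simp only [hy, PiLp.smul_apply, h1, if_false, h2, sg, smul_eq_mul]
    have hsg : ∀ j, sg s j * sg s j = 1 := by
      intro j
      simp only [sg]
      split_ifs <;> norm_num
    have hyj' : ∀ j, j ≠ i → 0 < sg s j * y (Fin.castLE hk j) := by
      intro j hj
      rw [hyj j hj]
      nlinarith [hsg j]
    have hsimple : (φ ⁻¹' {h.symm y}).encard = 1 := by
      rw [H.encard_preimage (H.symm_mem _), encard_eq_one]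
      refine ⟨i, ?_⟩
      ext j
      simp only [mem_ofPred_eq, mem_singleton_iff, H.apply_symm]
      refine ⟨fun h0 => ?_, fun h0 => h0 ▸ hyi⟩
      by_contra hj
      have := hyj' j hj
      rw [h0] at this
      simp at this
    have hev : ∀ᶠ q in 𝓝 (h.symm y), q ∈ h.source ∧ h q ∈ Metric.ball (0 : E3) ε ∧
        ∀ j, j ≠ i → 0 < sg s j * h q (Fin.castLE hk j) := by
      refine (h.open_source.eventually_mem (H.symm_mem y)).and ?_
      have hc := h.continuousAt (H.symm_mem y)
      refine hc.eventually (p := fun z => z ∈ Metric.ball (0 : E3) ε ∧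
        ∀ j, j ≠ i → 0 < sg s j * z (Fin.castLE hk j)) ?_
      rw [H.apply_symm]
      refine (Metric.isOpen_ball.eventually_mem htb).and (eventually_all.mpr fun j => ?_)
      by_cases hj : j = i
      · exact Eventually.of_forall fun z hz => absurd hj hz
      · have hcj : Continuous fun z : E3 => sg s j * z (Fin.castLE hk j) :=
          continuous_const.mul (continuous_coord _)
        filter_upwards [continuousAt_const.eventually_lt hcj.continuousAt (hyj' j hj)] with z hz _
        exact hz
    have hcases : ∀ q, q ∈ h.source → h q ∈ Metric.ball (0 : E3) ε →
        (∀ j, j ≠ i → 0 < sg s j * h q (Fin.castLE hk j)) → q ∉ range φ →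
        h q ∈ O s ∨ h q ∈ O (insert i s) := by
      intro q hq hqb hqj hqr
      have hqi : h q (Fin.castLE hk i) ≠ 0 := by
        intro h0
        apply hqr
        rw [H.mem_range_iff hq, coordProd]
        exact Finset.prod_eq_zero (Finset.mem_univ i) h0
      rcases lt_or_gt_of_ne hqi with hneg | hpos
      · right
        rw [hO]
        refine ⟨hqb, fun j => ?_⟩
        by_cases hj : j = i
        · subst hj
          simp only [sg, Finset.mem_insert_self, if_true]
          linarith
        · have := hqj j hj
          simpa [sg, hj] using this
      · left
        rw [hO]
        refine ⟨hqb, fun j => ?_⟩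
        by_cases hj : j = i
        · subst hj
          simp only [sg, his, if_false]
          linarith
        · exact hqj j hj
    obtain ⟨hf1, hf2⟩ := (hball y htb).2 hsimple
    obtain ⟨q1, ⟨hr1, hA1⟩, hs1, hb1, hj1⟩ := (hf1.and_eventually hev).exists
    obtain ⟨q2, ⟨hr2, hA2⟩, hs2, hb2, hj2⟩ := (hf2.and_eventually hev).exists
    have e1 : a s ∨ a (insert i s) := by
      refine (hcases q1 hs1 hb1 hj1 hr1).imp (fun hm => ?_) fun hm => ?_
      · rw [← ha _ _ hm, h.left_inv hs1]
        exact hA1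
      · rw [← ha _ _ hm, h.left_inv hs1]
        exact hA1
    have e2 : ¬ a s ∨ ¬ a (insert i s) := by
      refine (hcases q2 hs2 hb2 hj2 hr2).imp (fun hm => ?_) fun hm => ?_
      · rw [← ha _ _ hm, h.left_inv hs2]
        exact hA2
      · rw [← ha _ _ hm, h.left_inv hs2]
        exact hA2
    tauto
  have hpar : ∀ s : Finset (Fin k), a s ↔ (a ∅ ↔ Even s.card) := by
    intro s
    induction s using Finset.induction_on with
    | empty => simp
    | insert i s his ih =>
      rw [hflip s i his, ih, Finset.card_insert_of_notMem his, Nat.even_add_one]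
      tauto
  -- The sign is read off from the colour of the positive orthant. Elsewhere the parity of the
  -- number of negative coordinates is the sign of their product.
  refine ⟨if a ∅ then 1 else -1, by split_ifs <;> simp, ?_⟩
  have hev : ∀ᶠ q in 𝓝 p, q ∈ h.source ∧ h q ∈ Metric.ball (0 : E3) ε := by
    refine (h.open_source.eventually_mem H.mem_source).and
      ((h.continuousAt H.mem_source).preimage_mem_nhds ?_)
    rw [H.map_eq_zero]
    exact Metric.ball_mem_nhds _ hε
  filter_upwards [hev] with q ⟨hq, hqb⟩ hqr
  rw [H.mem_range_iff hq] at hqr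
  have hne : ∀ j, h q (Fin.castLE hk j) ≠ 0 := fun j =>
    Finset.prod_ne_zero_iff.mp hqr j (Finset.mem_univ j)
  set s : Finset (Fin k) := Finset.univ.filter fun j => h q (Fin.castLE hk j) < 0 with hs
  have habs : ∀ j, h q (Fin.castLE hk j) = sg s j * |h q (Fin.castLE hk j)| := by
    intro j
    rcases lt_or_gt_of_ne (hne j) with h1 | h1
    · simp [sg, hs, h1, abs_of_neg h1]
    · simp [sg, hs, h1.not_gt, abs_of_pos h1]
  have hqO : h q ∈ O s := by
    rw [hO]
    refine ⟨hqb, fun j => ?_⟩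
    rcases lt_or_gt_of_ne (hne j) with h1 | h1
    · simp [sg, hs, h1]
    · simpa [sg, hs, h1.not_gt] using h1
  have hprod : coordProd hk (h q) = (-1) ^ s.card * ∏ j, |h q (Fin.castLE hk j)| := by
    rw [coordProd, Finset.prod_congr rfl fun j _ => habs j, Finset.prod_mul_distrib]
    congr 1
    simp [sg, Finset.prod_ite_mem]
  have hpos : 0 < ∏ j : Fin k, |h q (Fin.castLE hk j)| :=
    Finset.prod_pos fun j _ => abs_pos.mpr (hne j)
  have := ha s _ hqO
  rw [h.left_inv hq] at this
  rw [this, hpar s, hprod]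
  rcases Nat.even_or_odd s.card with he | ho
  · by_cases h0 : a ∅ <;> simp [h0, he, he.neg_one_pow, hpos, hpos.le]
  · have : ¬ Even s.card := Nat.not_even_iff_odd.mpr ho
    by_cases h0 : a ∅ <;> simp [h0, this, ho.neg_one_pow, hpos, hpos.le]

theorem frequently_notMem_range (H : IsNormalChart φ p hk h U) : ∃ᶠ q in 𝓝 p, q ∉ range φ := by
  let v : E3 := WithLp.toLp 2 fun _ => 1
  have htend : Tendsto (fun s : ℝ => h.symm (s • v)) (𝓝 0) (𝓝 p) := by
    have : Continuous fun s : ℝ => h.symm (s • v) := H.continuous_symm.comp (by fun_prop)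
    have h2 := this.tendsto 0
    simpa [H.symm_zero] using h2
  refine htend.frequently ((frequently_gt_nhds (0 : ℝ)).mono fun s hs => ?_)
  rw [H.mem_range_iff (H.symm_mem _), H.apply_symm, coordProd, ← ne_eq, Finset.prod_ne_zero_iff]
  intro j _
  simpa [v] using hs.ne'

end IsNormalChart

end SurfaceImmersion

/-! ### Gluing colourings over boxes -/

namespace SurfaceImmersion

open Set Filter Topology

/-- A relation between the endpoints of intervals that holds for short intervals and for the union
of two overlapping intervals holds for all intervals. -/
theorem interval_induction {Q : ℝ → ℝ → Prop} (hloc : ∀ u, ∃ δ > 0, Q (u - δ) (u + δ))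
    (hmono : ∀ a b a' b', Q a b → a ≤ a' → b' ≤ b → Q a' b')
    (hglue : ∀ a b c d, Q a c → Q b d → a ≤ b → b < c → c ≤ d → Q a d) (a b : ℝ) : Q a b := by
  -- Two reals are related when one good open interval contains both. In the transitivity step the
  -- middle point lies in both intervals, which gives the overlap required for gluing.
  have key := isPreconnected_univ.induction₂' (α := ℝ)
    (fun u v => ∃ c d, c < u ∧ c < v ∧ u < d ∧ v < d ∧ Q c d)
    (by
      intro u _
      obtain ⟨δ, hδ, hQ⟩ := hloc u
      apply eventually_nhdsWithin_of_eventually_nhds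
      filter_upwards [Ioo_mem_nhds (show u - δ < u by linarith) (show u < u + δ by linarith)]
        with v hv
      exact ⟨⟨u - δ, u + δ, by linarith, hv.1, by linarith, hv.2, hQ⟩,
        ⟨u - δ, u + δ, hv.1, by linarith, hv.2, by linarith, hQ⟩⟩)
    (by
      rintro u v w - - - ⟨c₁, d₁, h1, h2, h3, h4, hQ₁⟩ ⟨c₂, d₂, k1, k2, k3, k4, hQ₂⟩
      refine ⟨min c₁ c₂, max d₁ d₂, (min_le_left _ _).trans_lt h1, (min_le_right _ _).trans_lt k2,
        h3.trans_le (le_max_left _ _), k4.trans_le (le_max_right _ _), ?_⟩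
      rcases le_total c₁ c₂ with hc | hc <;> rcases le_total d₁ d₂ with hd | hd
      · rw [min_eq_left hc, max_eq_right hd]
        exact hglue _ _ _ _ hQ₁ hQ₂ hc (by linarith) hd
      · rw [min_eq_left hc, max_eq_left hd]
        exact hQ₁
      · rw [min_eq_right hc, max_eq_right hd]
        exact hQ₂
      · rw [min_eq_right hc, max_eq_left hd]
        exact hglue _ _ _ _ hQ₂ hQ₁ hc (by linarith) hd)
    (mem_univ a) (mem_univ b)
  obtain ⟨c, d, h1, -, -, h4, hQ⟩ := key
  exact hmono _ _ _ _ hQ h1.le h4.le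

/-- The complement of the image of `φ` in `V` has a checkerboard colouring. -/
def Colourable {S : Type*} (φ : S → E3) (V : Set E3) : Prop :=
  ∃ A, ∀ p ∈ V, IsColouringAt φ A p

theorem Colourable.mono {S : Type*} {φ : S → E3} {V W : Set E3} (h : Colourable φ W)
    (hVW : V ⊆ W) : Colourable φ V := by
  obtain ⟨A, hA⟩ := h
  exact ⟨A, fun p hp => hA p (hVW hp)⟩

variable {S : Type*} [TopologicalSpace S] {φ : S → E3}

/-- In one normal chart both colourings are given by the sign of the same coordinate product, each
up to a global sign. -/
theorem colourings_agree_or {p : E3} (hp : IsNormalCrossingAt φ p) {A A' : Set E3}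
    (hA : ∀ᶠ q in 𝓝 p, IsColouringAt φ A q) (hA' : ∀ᶠ q in 𝓝 p, IsColouringAt φ A' q) :
    (∀ᶠ q in 𝓝 p, q ∉ range φ → (q ∈ A ↔ q ∈ A')) ∨
      ∀ᶠ q in 𝓝 p, q ∉ range φ → (q ∈ A ↔ q ∉ A') := by
  obtain ⟨k, hk, h, U, H⟩ := hp.exists_chart
  obtain ⟨σ, hσ, he⟩ := H.eventually_colour hA
  obtain ⟨σ', hσ', he'⟩ := H.eventually_colour hA'
  have hs := h.open_source.eventually_mem H.mem_source
  by_cases hσσ : σ = σ'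
  · left
    filter_upwards [he, he'] with q h1 h2 hq
    rw [h1 hq, h2 hq, hσσ]
  · right
    have : σ' = -σ := by
      rcases hσ with rfl | rfl <;> rcases hσ' with rfl | rfl <;> first | exact absurd rfl hσσ | norm_num
    subst this
    filter_upwards [he, he', hs] with q h1 h2 h3 hq
    have hne : coordProd hk (h q) ≠ 0 := mt (H.mem_range_iff h3).mpr hq
    have hσ0 : σ * coordProd hk (h q) ≠ 0 :=
      mul_ne_zero (by rcases hσ with rfl | rfl <;> norm_num) hne
    rw [h1 hq, h2 hq, neg_mul, neg_pos, not_lt]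
    exact ⟨fun h => h.le, fun h => lt_of_le_of_ne h hσ0.symm⟩

/-- Use `A` on `V` and `B` elsewhere. The result agrees with `A` near points of `V`, and off the
image with `B` near points of `W`. -/
theorem colourable_union_of_agree {S : Type*} {φ : S → E3} (hcl : IsClosed (range φ)) {V W : Set E3} (hV : IsOpen V)
    (hW : IsOpen W) {A B : Set E3} (hA : ∀ p ∈ V, IsColouringAt φ A p)
    (hB : ∀ p ∈ W, IsColouringAt φ B p)
    (hAB : ∀ p ∈ V ∩ W, ∀ᶠ q in 𝓝 p, q ∉ range φ → (q ∈ A ↔ q ∈ B)) : Colourable φ (V ∪ W) := by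
  refine ⟨{q | (q ∈ V ∧ q ∈ A) ∨ (q ∉ V ∧ q ∈ B)}, ?_⟩
  rintro p (hp | hp)
  · refine (hA p hp).congr hcl ?_
    filter_upwards [hV.mem_nhds hp] with q hq _
    simp [hq]
  · refine (hB p hp).congr hcl ?_
    filter_upwards [hW.mem_nhds hp] with q hq hr
    by_cases hqV : q ∈ V
    · have := (hAB q ⟨hqV, hq⟩).self_of_nhds hr
      simp [hqV, this]
    · simp [hqV]

/-- At each point of the overlap the two colourings locally agree or locally disagree. Both cannot
happen, because off-image points accumulate everywhere. Each alternative is open, so one of them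
holds on the whole connected overlap, and `B` is replaced by its complement if necessary. -/
theorem Colourable.union (hφ : ∀ p, IsNormalCrossingAt φ p) (hcl : IsClosed (range φ))
    {V W : Set E3} (hV : IsOpen V) (hW : IsOpen W) (hVW : IsPreconnected (V ∩ W))
    (h : Colourable φ V) (h' : Colourable φ W) : Colourable φ (V ∪ W) := by
  obtain ⟨A, hA⟩ := h
  obtain ⟨B, hB⟩ := h'
  let P : E3 → Prop := fun p => ∀ᶠ q in 𝓝 p, q ∉ range φ → (q ∈ A ↔ q ∈ B)
  have hor : ∀ p ∈ V ∩ W, P p ∨ ∀ᶠ q in 𝓝 p, q ∉ range φ → (q ∈ A ↔ q ∉ B) := fun p hp =>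
    colourings_agree_or (hφ p) (eventually_of_mem (hV.mem_nhds hp.1) hA)
      (eventually_of_mem (hW.mem_nhds hp.2) hB)
  have hnot : ∀ p, (∀ᶠ q in 𝓝 p, q ∉ range φ → (q ∈ A ↔ q ∉ B)) → ¬ P p := by
    intro p hp hP
    obtain ⟨k, hk, h, U, H⟩ := (hφ p).exists_chart
    obtain ⟨q, hq, h1, h2⟩ := (H.frequently_notMem_range.and_eventually (hp.and hP)).exists
    have h1 := h1 hq
    have h2 := h2 hq
    tauto
  by_cases hall : ∀ p ∈ V ∩ W, P p
  · exact colourable_union_of_agree hcl hV hW hA hB hall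
  · push Not at hall
    obtain ⟨p₀, hp₀, hn⟩ := hall
    refine colourable_union_of_agree hcl hV hW hA (B := Bᶜ) (fun p hp => (hB p hp).compl) ?_
    intro p hp
    have : P p₀ ↔ P p := by
      refine hVW.induction₂' (fun p p' => P p ↔ P p') ?_ (fun a b c _ _ _ h1 h2 => h1.trans h2) hp₀ hp
      intro x hx
      apply eventually_nhdsWithin_of_eventually_nhds
      by_cases hPx : P x
      · filter_upwards [eventually_eventually_nhds.mpr hPx] with y hy
        have hy : P y := hy
        simp [hPx, hy]
      · filter_upwards [eventually_eventually_nhds.mpr ((hor x hx).resolve_left hPx)] with y hy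
        have hy : ¬ P y := hnot y hy
        simp [hPx, hy]
    exact (hor p hp).resolve_left (fun h => hn (this.mpr h))

theorem exists_colourable_nhds {p : E3} (hp : IsNormalCrossingAt φ p) :
    ∃ δ > 0, Colourable φ (Metric.ball p δ) := by
  obtain ⟨k, hk, h, U, H⟩ := hp.exists_chart
  obtain ⟨δ, hδ, hb⟩ := Metric.isOpen_iff.mp h.open_source p H.mem_source
  exact ⟨δ, hδ, _, fun q hq => H.isColouringAt (hb hq)⟩

/-- The open box whose `i`-th side is the interval `(a i, b i)`. -/
def openBox (a b : Fin 3 → ℝ) : Set E3 :=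
  {x | ∀ i, x i ∈ Ioo (a i) (b i)}

theorem isOpen_openBox (a b : Fin 3 → ℝ) : IsOpen (openBox a b) := by
  have : openBox a b = ⋂ i, (fun x : E3 => x i) ⁻¹' Ioo (a i) (b i) := by
    ext x
    simp [openBox]
  rw [this]
  exact isOpen_iInter_of_finite fun i => isOpen_Ioo.preimage (continuous_coord i)

theorem convex_openBox (a b : Fin 3 → ℝ) : Convex ℝ (openBox a b) := by
  have : openBox a b = ⋂ i, (fun x : E3 => x i) ⁻¹' Ioo (a i) (b i) := by
    ext x
    simp [openBox]
  rw [this]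
  exact convex_iInter fun i =>
    (convex_Ioo (a i) (b i)).linear_preimage (EuclideanSpace.proj i : E3 →L[ℝ] ℝ).toLinearMap

theorem openBox_mono {a b a' b' : Fin 3 → ℝ} (ha : a' ≤ a) (hb : b ≤ b') :
    openBox a b ⊆ openBox a' b' :=
  fun _ hx i => ⟨(ha i).trans_lt (hx i).1, (hx i).2.trans_le (hb i)⟩

/-- Extending colourings of boxes along the `j`-th coordinate. -/
theorem colourable_extend (hφ : ∀ p, IsNormalCrossingAt φ p) (hcl : IsClosed (range φ))
    (R : ℝ) (j : Fin 3) (F : Finset (Fin 3)) (hj : j ∉ F)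
    (ih : ∀ c : Fin 3 → ℝ, ∃ δ > 0, Colourable φ (openBox (fun i => if i ∈ F then -R else c i - δ)
      (fun i => if i ∈ F then R else c i + δ))) (c : Fin 3 → ℝ) :
    ∃ δ > 0, Colourable φ (openBox (fun i => if i ∈ insert j F then -R else c i - δ)
      (fun i => if i ∈ insert j F then R else c i + δ)) := by
  -- The thickness `δ` in the remaining directions may depend on the interval in direction `j`.
  -- Gluing takes the smaller of the two, and two such boxes meet in a convex set.
  have key := interval_induction (Q := fun u v => ∃ δ > 0, Colourable φ
    (openBox (Function.update (fun i => if i ∈ F then -R else c i - δ) j u)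
      (Function.update (fun i => if i ∈ F then R else c i + δ) j v))) ?_ ?_ ?_ (-R) R
  · obtain ⟨δ, hδ, h⟩ := key
    refine ⟨δ, hδ, h.mono (openBox_mono ?_ ?_)⟩ <;>
    · intro i
      by_cases hi : i = j
      · subst hi
        simp
      · simp [hi]
  · intro u
    obtain ⟨δ, hδ, h⟩ := ih (Function.update c j u)
    refine ⟨δ, hδ, δ, hδ, h.mono (openBox_mono ?_ ?_)⟩ <;>
    · intro i
      by_cases hi : i = j
      · subst hi
        simp [hj]
      · simp [hi]
  · rintro a b a' b' ⟨δ, hδ, h⟩ ha hb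
    exact ⟨δ, hδ, h.mono (openBox_mono (update_le_update_iff.mpr ⟨ha, fun _ _ => le_rfl⟩)
      (update_le_update_iff.mpr ⟨hb, fun _ _ => le_rfl⟩))⟩
  · rintro a b c' d ⟨δ₁, hδ₁, h₁⟩ ⟨δ₂, hδ₂, h₂⟩ hab hbc hcd
    refine ⟨min δ₁ δ₂, lt_min hδ₁ hδ₂, ?_⟩
    have hlo : ∀ δ, min δ₁ δ₂ ≤ δ → (fun i => if i ∈ F then -R else c i - δ) ≤
        fun i => if i ∈ F then -R else c i - min δ₁ δ₂ := by
      intro δ hδ i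
      dsimp only
      split_ifs <;> linarith
    have hhi : ∀ δ, min δ₁ δ₂ ≤ δ → (fun i => if i ∈ F then R else c i + min δ₁ δ₂) ≤
        fun i => if i ∈ F then R else c i + δ := by
      intro δ hδ i
      dsimp only
      split_ifs <;> linarith
    have e₁ := h₁.mono (openBox_mono
      (update_le_update_iff.mpr ⟨le_refl a, fun i _ => hlo δ₁ (min_le_left _ _) i⟩)
      (update_le_update_iff.mpr ⟨le_refl c', fun i _ => hhi δ₁ (min_le_left _ _) i⟩))
    have e₂ := h₂.mono (openBox_mono
      (update_le_update_iff.mpr ⟨le_refl b, fun i _ => hlo δ₂ (min_le_right _ _) i⟩)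
      (update_le_update_iff.mpr ⟨le_refl d, fun i _ => hhi δ₂ (min_le_right _ _) i⟩))
    refine (Colourable.union hφ hcl (isOpen_openBox _ _) (isOpen_openBox _ _)
      ((convex_openBox _ _).inter (convex_openBox _ _)).isPreconnected e₁ e₂).mono ?_
    intro x hx
    have hxj := hx j
    simp only [Function.update_self] at hxj
    have hrest : ∀ i, i ≠ j → x i ∈ Ioo ((fun i => if i ∈ F then -R else c i - min δ₁ δ₂) i)
        ((fun i => if i ∈ F then R else c i + min δ₁ δ₂) i) := by
      intro i hi
      have := hx i
      rwa [Function.update_of_ne hi, Function.update_of_ne hi] at this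
    rcases lt_or_ge (x j) c' with hlt | hge
    · left
      intro i
      by_cases hi : i = j
      · subst hi
        simp only [Function.update_self]
        exact ⟨hxj.1, hlt⟩
      · rw [Function.update_of_ne hi, Function.update_of_ne hi]
        exact hrest i hi
    · right
      intro i
      by_cases hi : i = j
      · subst hi
        simp only [Function.update_self]
        exact ⟨hbc.trans_le hge, hxj.2⟩
      · rw [Function.update_of_ne hi, Function.update_of_ne hi]
        exact hrest i hi

/-- Small cubes are lengthened in one coordinate direction at a time, `F` being the set of
directions already done. The centre must remain arbitrary, since each extension needs small boxes
all along a line. -/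
theorem colourable_box (hφ : ∀ p, IsNormalCrossingAt φ p) (hcl : IsClosed (range φ)) (R : ℝ)
    (F : Finset (Fin 3)) (c : Fin 3 → ℝ) :
    ∃ δ > 0, Colourable φ (openBox (fun i => if i ∈ F then -R else c i - δ)
      (fun i => if i ∈ F then R else c i + δ)) := by
  induction F using Finset.induction_on generalizing c with
  | empty =>
    obtain ⟨δ, hδ, h⟩ := exists_colourable_nhds (hφ (WithLp.toLp 2 c))
    refine ⟨δ / 2, by positivity, h.mono fun x hx => ?_⟩
    have h1 : ‖x - WithLp.toLp 2 c‖ ^ 2 ≤ 3 * (δ / 2) ^ 2 := by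
      rw [EuclideanSpace.norm_sq_eq, Fin.sum_univ_three]
      have : ∀ i, ‖(x - WithLp.toLp 2 c) i‖ ^ 2 ≤ (δ / 2) ^ 2 := by
        intro i
        have hi := hx i
        simp only [Finset.notMem_empty, if_false, mem_Ioo] at hi
        refine pow_le_pow_left₀ (norm_nonneg _) ?_ 2
        rw [Real.norm_eq_abs, abs_le]
        simp only [PiLp.sub_apply]
        constructor <;> linarith
      linarith [this 0, this 1, this 2]
    rw [mem_ball_iff_norm]
    nlinarith [norm_nonneg (x - WithLp.toLp 2 c)]
  | insert j F hj ih => exact colourable_extend hφ hcl R j F hj ih c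

/-- The complement of the image of `φ` in a ball has a checkerboard colouring. -/
theorem colourable_ball (hφ : ∀ p, IsNormalCrossingAt φ p) (hcl : IsClosed (range φ)) (R : ℝ) :
    Colourable φ (Metric.ball 0 R) := by
  obtain ⟨δ, -, h⟩ := colourable_box hφ hcl R Finset.univ 0
  refine h.mono fun x hx i => ?_
  have h1 : ‖x i‖ ≤ ‖x‖ := PiLp.norm_apply_le x i
  rw [mem_ball_zero_iff] at hx
  rw [Real.norm_eq_abs] at h1
  have := abs_lt.mp (h1.trans_lt hx)
  simpa using this

end SurfaceImmersion

/-! ### Germs of local homeomorphisms and reflections -/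

namespace SurfaceImmersion

open Set Filter Topology

theorem sphereHomotopic_of_unitInterval {K : unitInterval × Metric.sphere (0 : E3) 1 → E3}
    (hK : Continuous K) (h0 : ∀ q, K q ≠ 0) {f g : Metric.sphere (0 : E3) 1 → E3}
    (hf : ∀ x, K (0, x) = f x) (hg : ∀ x, K (1, x) = g x) : SphereHomotopic f g := by
  have hK' : Continuous fun q => (⟨K q, h0 q⟩ : {x : E3 // x ≠ 0}) := hK.subtype_mk _
  refine ⟨⟨fun x => ⟨K (0, x), h0 _⟩, hK'.comp (f := fun x => ((0 : unitInterval), x)) (by fun_prop)⟩,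
    ⟨fun x => ⟨K (1, x), h0 _⟩, hK'.comp (f := fun x => ((1 : unitInterval), x)) (by fun_prop)⟩,
    hf, hg, ⟨⟨⟨_, hK'⟩, fun x => rfl, fun x => rfl⟩⟩⟩

theorem sphere_abs_le (x : Metric.sphere (0 : E3) 1) (i : Fin 3) : |(x : E3) i| ≤ 1 := by
  have h1 : ‖(x : E3) i‖ ≤ ‖(x : E3)‖ := PiLp.norm_apply_le _ i
  rwa [norm_eq_of_mem_sphere, Real.norm_eq_abs] at h1

theorem sphere_ne_zero (x : Metric.sphere (0 : E3) 1) : (x : E3) ≠ 0 := by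
  intro h
  have := norm_eq_of_mem_sphere x
  rw [h] at this
  simp at this

theorem mem_segment_pos {a b τ : ℝ} (ha : 0 < a) (hb : 0 < b) (hτ : τ ∈ Icc (0 : ℝ) 1) :
    0 < (1 - τ) * a + τ * b := by
  rcases hτ.1.eq_or_lt with h | h
  · subst h
    simpa using ha
  · have : 0 < τ * b := by positivity
    have : 0 ≤ (1 - τ) * a := mul_nonneg (by linarith [hτ.2]) ha.le
    linarith

theorem mem_segment_le {a b c τ : ℝ} (ha : a ≤ c) (hb : b ≤ c) (hτ : τ ∈ Icc (0 : ℝ) 1) :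
    (1 - τ) * a + τ * b ≤ c := by
  nlinarith [hτ.1, hτ.2]

theorem sphereHomotopic_smul {ρ : ℝ} (hρ : 0 < ρ) {f : Metric.sphere (0 : E3) 1 → E3}
    (hf : Continuous f) (h0 : ∀ x, f x ≠ 0) : SphereHomotopic f (fun x => ρ • f x) := by
  refine sphereHomotopic_of_unitInterval
    (K := fun q => ((1 - (q.1 : ℝ)) * 1 + q.1 * ρ) • f q.2) (by fun_prop)
    (fun q => smul_ne_zero (mem_segment_pos one_pos hρ q.1.2).ne' (h0 _)) ?_ ?_
  · intro x
    simp
  · intro x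
    simp

/-- Shrinking the radius does not change the homotopy class of a germ. -/
theorem sphereHomotopic_radius {F : E3 → E3} {ρ ρ' : ℝ} (hρ' : 0 < ρ') (hρ : 0 < ρ) (hle : ρ' ≤ ρ)
    (hc : ContinuousOn F (Metric.closedBall 0 ρ)) {p : E3}
    (h0 : ∀ x ∈ Metric.closedBall (0 : E3) ρ, x ≠ 0 → F x ≠ p) :
    SphereHomotopic (fun x => F (ρ • (x : E3)) - p) (fun x => F (ρ' • (x : E3)) - p) := by
  have hmem : ∀ q : unitInterval × Metric.sphere (0 : E3) 1,
      ((1 - (q.1 : ℝ)) * ρ + q.1 * ρ') • (q.2 : E3) ∈ Metric.closedBall (0 : E3) ρ := by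
    intro q
    rw [mem_closedBall_zero_iff, norm_smul, norm_eq_of_mem_sphere, mul_one,
      Real.norm_of_nonneg (mem_segment_pos hρ hρ' q.1.2).le]
    exact mem_segment_le le_rfl hle q.1.2
  refine sphereHomotopic_of_unitInterval
    (K := fun q => F (((1 - (q.1 : ℝ)) * ρ + q.1 * ρ') • (q.2 : E3)) - p) ?_ ?_ ?_ ?_
  · exact (hc.comp_continuous (by fun_prop) hmem).sub continuous_const
  · intro q
    rw [sub_ne_zero]
    exact h0 _ (hmem q) (smul_ne_zero (mem_segment_pos hρ hρ' q.1.2).ne' (sphere_ne_zero _))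
  · intro x
    simp
  · intro x
    simp

/-- The germ of a homeomorphism is not homotopic to its composition with a reflection. -/
theorem not_sphereHomotopic_of_injOn {F : E3 → E3} {ρ : ℝ} (hρ : 0 < ρ)
    (hc : ContinuousOn F (Metric.closedBall 0 ρ)) (hinj : InjOn F (Metric.closedBall 0 ρ))
    (hnhds : F '' Metric.closedBall 0 ρ ∈ 𝓝 (F 0)) :
    ¬ SphereHomotopic (fun x => F (ρ • (x : E3)) - F 0)
      (fun x => F (ρ • (sphereReflect x : E3)) - F 0) := by
  intro hh
  obtain ⟨δ, hδ, hball⟩ := Metric.mem_nhds_iff.mp hnhds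
  have h0mem : (0 : E3) ∈ Metric.closedBall (0 : E3) ρ := by simp [hρ.le]
  have hne : ∀ x ∈ Metric.closedBall (0 : E3) ρ, x ≠ 0 → F x ≠ F 0 :=
    fun x hx hx0 h => hx0 (hinj hx h0mem h)
  -- The small sphere must be mapped into the ball of radius `δ` around `F 0`, on which the inverse
  -- of `F` is available.
  obtain ⟨ρ', hρ', hle, hsmall⟩ : ∃ ρ' > 0, ρ' ≤ ρ ∧
      ∀ x : Metric.sphere (0 : E3) 1, ‖F (ρ' • (x : E3)) - F 0‖ ≤ δ / 2 := by
    have hcw := hc 0 h0mem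
    rw [Metric.continuousWithinAt_iff] at hcw
    obtain ⟨η, hη, hF⟩ := hcw (δ / 2) (by positivity)
    refine ⟨min ρ (η / 2), by positivity, min_le_left _ _, fun x => ?_⟩
    have hpos : 0 < min ρ (η / 2) := by positivity
    have hn : ‖min ρ (η / 2) • (x : E3)‖ = min ρ (η / 2) := by
      rw [norm_smul, norm_eq_of_mem_sphere, mul_one, Real.norm_of_nonneg hpos.le]
    have := hF (x := min ρ (η / 2) • (x : E3)) (by
      rw [mem_closedBall_zero_iff, hn]
      exact min_le_left _ _) (by
      rw [dist_zero_right, hn]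
      exact (min_le_right _ _).trans_lt (by linarith))
    rw [dist_eq_norm] at this
    exact this.le
  have hshrink := sphereHomotopic_radius hρ' hρ hle hc hne
  have hh' : SphereHomotopic (fun x => F (ρ' • (x : E3)) - F 0)
      (fun x => F (ρ' • (sphereReflect x : E3)) - F 0) :=
    hshrink.symm.trans (hh.trans hshrink.comp_reflect)
  classical
  have hemb : IsEmbedding (fun x : Metric.closedBall (0 : E3) ρ => F x) := by
    have : CompactSpace (Metric.closedBall (0 : E3) ρ) :=
      isCompact_iff_compactSpace.mp (isCompact_closedBall _ _)
    exact ((continuousOn_iff_continuous_domRestrict.mp hc).isClosedEmbedding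
      (injOn_iff_injective.mp hinj)).isEmbedding
  let e := hemb.toHomeomorph
  -- `G` inverts `F` on the image of the ball; its value `0` elsewhere plays no role.
  let G : E3 → E3 := fun q => if hq : q ∈ range (fun x : Metric.closedBall (0 : E3) ρ => F x) then
    (e.symm ⟨q, hq⟩ : E3) else 0
  have hrange : range (fun x : Metric.closedBall (0 : E3) ρ => F x) = F '' Metric.closedBall 0 ρ := by
    rw [image_eq_range]
  have hGF : ∀ x ∈ Metric.closedBall (0 : E3) ρ, G (F x) = x := by
    intro x hx
    have hq : F x ∈ range (fun x : Metric.closedBall (0 : E3) ρ => F x) := ⟨⟨x, hx⟩, rfl⟩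
    simp only [G, dif_pos hq]
    have : e ⟨x, hx⟩ = ⟨F x, hq⟩ := rfl
    rw [← this, e.symm_apply_apply]
  have hGc : ContinuousOn G (F '' Metric.closedBall 0 ρ) := by
    rw [← hrange, continuousOn_iff_continuous_domRestrict]
    have : (range (fun x : Metric.closedBall (0 : E3) ρ => F x)).domRestrict G =
        fun q => (e.symm q : E3) := by
      ext1 q
      exact dif_pos q.2
    rw [this]
    exact continuous_subtype_val.comp e.symm.continuous
  have hG0 : ∀ v : E3, v ≠ 0 → ‖v‖ < δ → G (F 0 + v) ≠ 0 := by
    intro v hv hvδ h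
    have hm : F 0 + v ∈ F '' Metric.closedBall 0 ρ := hball (by simpa using hvδ)
    obtain ⟨x, hx, hxv⟩ := hm
    rw [← hxv, hGF x hx] at h
    rw [h] at hxv
    exact hv (by simpa using hxv.symm)
  have hGc' : ∀ {X : Type} [TopologicalSpace X] (v : X → E3), Continuous v → (∀ x, ‖v x‖ < δ) →
      Continuous fun x => G (F 0 + v x) := by
    intro X _ v hv hvδ
    exact hGc.comp_continuous (continuous_const.add hv) fun x => hball (by simpa using hvδ x)
  -- The given homotopy in punctured space may leave the domain of `G`. It is therefore normalized
  -- to the sphere of radius `δ / 2`, and this radial homotopy connects its ends to the original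
  -- maps. Applying `G` then gives a homotopy from a multiple of the identity to the same multiple
  -- of the reflection.
  have hrad : ∀ u : Metric.sphere (0 : E3) 1 → E3, Continuous u → (∀ x, u x ≠ 0) →
      (∀ x, ‖u x‖ ≤ δ / 2) → SphereHomotopic (fun x => G (F 0 + u x))
        (fun x => G (F 0 + (δ / 2 / ‖u x‖) • u x)) := by
    intro u hu hu0 huδ
    have hpos : ∀ q : unitInterval × Metric.sphere (0 : E3) 1,
        0 < (1 - (q.1 : ℝ)) * 1 + q.1 * (δ / 2 / ‖u q.2‖) := fun q =>
      mem_segment_pos one_pos (div_pos (by positivity) (norm_pos_iff.mpr (hu0 _))) q.1.2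
    have hlt : ∀ q : unitInterval × Metric.sphere (0 : E3) 1,
        ‖((1 - (q.1 : ℝ)) * 1 + q.1 * (δ / 2 / ‖u q.2‖)) • u q.2‖ < δ := by
      intro q
      have hn : 0 < ‖u q.2‖ := norm_pos_iff.mpr (hu0 _)
      rw [norm_smul, Real.norm_of_nonneg (hpos q).le]
      have : ((1 - (q.1 : ℝ)) * 1 + q.1 * (δ / 2 / ‖u q.2‖)) * ‖u q.2‖ =
          (1 - (q.1 : ℝ)) * ‖u q.2‖ + q.1 * (δ / 2) := by
        field_simp
      rw [this]
      linarith [mem_segment_le (huδ q.2) (le_refl (δ / 2)) q.1.2]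
    refine sphereHomotopic_of_unitInterval
      (K := fun q => G (F 0 + ((1 - (q.1 : ℝ)) * 1 + q.1 * (δ / 2 / ‖u q.2‖)) • u q.2)) ?_ ?_ ?_ ?_
    · refine hGc' _ (Continuous.fun_smul ?_ (hu.comp continuous_snd)) hlt
      have : Continuous fun q : unitInterval × Metric.sphere (0 : E3) 1 => δ / 2 / ‖u q.2‖ :=
        continuous_const.div (hu.comp continuous_snd).norm fun q => norm_ne_zero_iff.mpr (hu0 _)
      fun_prop
    · intro q
      exact hG0 _ (smul_ne_zero (hpos q).ne' (hu0 _)) (hlt q)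
    · intro x
      simp
    · intro x
      simp
  have hmemρ' : ∀ x : Metric.sphere (0 : E3) 1, ρ' • (x : E3) ∈ Metric.closedBall (0 : E3) ρ := by
    intro x
    rw [mem_closedBall_zero_iff, norm_smul, norm_eq_of_mem_sphere, mul_one,
      Real.norm_of_nonneg hρ'.le]
    exact hle
  let f : Metric.sphere (0 : E3) 1 → E3 := fun x => F (ρ' • (x : E3)) - F 0
  have hfc : Continuous f :=
    (hc.comp_continuous (by fun_prop) hmemρ').sub continuous_const
  have hf0 : ∀ x, f x ≠ 0 := fun x => sub_ne_zero.mpr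
    (hne _ (hmemρ' x) (smul_ne_zero hρ'.ne' (sphere_ne_zero x)))
  have hGf : ∀ x, G (F 0 + f x) = ρ' • (x : E3) := by
    intro x
    simp only [f, add_sub_cancel]
    exact hGF _ (hmemρ' x)
  have s1 := hrad f hfc hf0 hsmall
  have s2 := s1.comp_reflect
  have s3 : SphereHomotopic (fun x => G (F 0 + (δ / 2 / ‖f x‖) • f x))
      ((fun x => G (F 0 + (δ / 2 / ‖f x‖) • f x)) ∘ sphereReflect) := by
    obtain ⟨K, hK, hK0, hKf, hKg⟩ := hh'.exists_family
    have hlt : ∀ q, ‖(δ / 2 / ‖K q‖) • K q‖ < δ := by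
      intro q
      have hn : ‖K q‖ ≠ 0 := norm_ne_zero_iff.mpr (hK0 _)
      rw [norm_smul, Real.norm_of_nonneg (by positivity), div_mul_cancel₀ _ hn]
      linarith
    refine sphereHomotopic_of_unitInterval (K := fun q => G (F 0 + (δ / 2 / ‖K q‖) • K q)) ?_ ?_ ?_ ?_
    · refine hGc' _ (Continuous.fun_smul ?_ hK) hlt
      exact continuous_const.div hK.norm fun q => norm_ne_zero_iff.mpr (hK0 _)
    · intro q
      refine hG0 _ (smul_ne_zero ?_ (hK0 _)) (hlt q)
      exact (div_pos (by positivity) (norm_pos_iff.mpr (hK0 _))).ne'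
    · intro x
      simp only [hKf, f]
    · intro x
      simp only [hKg, f, Function.comp_apply]
  have s4 : SphereHomotopic (fun x : Metric.sphere (0 : E3) 1 => ρ' • (x : E3)) (fun x => ρ' • (sphereReflect x : E3)) := by
    have e1 : (fun x => G (F 0 + f x)) = fun x : Metric.sphere (0 : E3) 1 => ρ' • (x : E3) := funext hGf
    have e2 : (fun x => G (F 0 + f x)) ∘ sphereReflect = fun x => ρ' • (sphereReflect x : E3) :=
      funext fun x => hGf _
    rw [← e2, ← e1]
    exact s1.trans (s3.trans s2.symm)
  have s5 := sphereHomotopic_smul hρ' continuous_subtype_val (fun x => sphere_ne_zero x)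
  exact not_sphereHomotopic_reflect (s5.trans (s4.trans s5.comp_reflect.symm))

end SurfaceImmersion

/-! ### Sheet charts and sided germs -/

namespace SurfaceImmersion

open Set Filter Topology

/-- Near `(t₀, 0)`, the parametrized surface `ψ` is injective and lies in the plane `x i = 0` of
the chart `h`. -/
structure IsSheetChart (ψ : ℝ × ℝ → E3) (t₀ r : ℝ) (h : OpenPartialHomeomorph E3 E3)
    (i : Fin 3) : Prop where
  continuous : Continuous ψ
  pos : 0 < r
  target_eq : h.target = univ
  mem_source : ∀ s v, |s - t₀| < r → |v| < r → ψ (s, v) ∈ h.source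
  coord_eq_zero : ∀ s v, |s - t₀| < r → |v| < r → h (ψ (s, v)) i = 0
  injective : ∀ s v s' v', |s - t₀| < r → |v| < r → |s' - t₀| < r → |v'| < r →
    ψ (s, v) = ψ (s', v') → s = s' ∧ v = v'

/-- The parametrization of a neighbourhood of `ψ (t, 0)` in which the third variable is the
signed distance, in the chart `h`, from the sheet. -/
noncomputable def chartMap (ψ : ℝ × ℝ → E3) (h : OpenPartialHomeomorph E3 E3) (i : Fin 3)
    (ε t : ℝ) (x : E3) : E3 :=
  h.symm (h (ψ (t + x 0, x 1)) + (ε * x 2) • EuclideanSpace.single i 1)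

/-- The spherical map that `chartMap` induces around `ψ (t, 0)`. -/
noncomputable def chartGerm (ψ : ℝ × ℝ → E3) (h : OpenPartialHomeomorph E3 E3) (i : Fin 3)
    (ε t ρ : ℝ) (x : Metric.sphere (0 : E3) 1) : E3 :=
  chartMap ψ h i ε t (ρ • (x : E3)) - ψ (t, 0)

/-- A spherical map around `ψ (t, 0)` that extends `ψ` and sends the upper hemisphere to the side
of the sheet that is coloured by `A`. -/
def IsSidedGerm (Z A : Set E3) (ψ : ℝ × ℝ → E3) (t : ℝ) (f : Metric.sphere (0 : E3) 1 → E3) :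
    Prop :=
  ∃ F : E3 → E3, ∃ ρ > 0, ContinuousOn F (Metric.closedBall 0 ρ) ∧
    (∀ x ∈ Metric.closedBall (0 : E3) ρ, x 2 = 0 → F x = ψ (t + x 0, x 1)) ∧
    (∀ x ∈ Metric.closedBall (0 : E3) ρ, 0 < x 2 → F x ∉ Z ∧ F x ∈ A) ∧
    (∀ x ∈ Metric.closedBall (0 : E3) ρ, x 2 < 0 → F x ∉ Z ∧ F x ∉ A) ∧
    (∀ x ∈ Metric.closedBall (0 : E3) ρ, x ≠ 0 → F x ≠ ψ (t, 0)) ∧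
    ∀ x, f x = F (ρ • (x : E3)) - ψ (t, 0)

/-- Near `q₀`, the image is the plane `x i = 0` of the chart `h`, and `A` lies on its side given by
the sign of `σ`. -/
def HasSide (Z A : Set E3) (h : OpenPartialHomeomorph E3 E3) (i : Fin 3) (σ : ℝ) (q₀ : E3) : Prop :=
  ∀ᶠ q in 𝓝 q₀, (q ∈ Z ↔ h q i = 0) ∧ (q ∉ Z → (q ∈ A ↔ 0 < σ * h q i))

/-- The parameter `ε` enters only through `ε * x 2`, so changing the side of the sheet amounts to
reflecting the source. -/
theorem chartGerm_neg (ψ : ℝ × ℝ → E3) (h : OpenPartialHomeomorph E3 E3) (i : Fin 3)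
    (ε t ρ : ℝ) : chartGerm ψ h i (-ε) t ρ = chartGerm ψ h i ε t ρ ∘ sphereReflect := by
  ext1 x
  simp [chartGerm, chartMap, sphereReflect]

namespace IsSheetChart

variable {ψ : ℝ × ℝ → E3} {t₀ r : ℝ} {h : OpenPartialHomeomorph E3 E3} {i : Fin 3}

theorem continuous_symm (H : IsSheetChart ψ t₀ r h i) : Continuous h.symm := by
  have := h.continuousOn_symm
  rwa [H.target_eq, continuousOn_univ] at this

theorem symm_mem (H : IsSheetChart ψ t₀ r h i) (y : E3) : h.symm y ∈ h.source :=
  h.map_target (H.target_eq ▸ mem_univ y)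

theorem apply_symm (H : IsSheetChart ψ t₀ r h i) (y : E3) : h (h.symm y) = y :=
  h.right_inv (H.target_eq ▸ mem_univ y)

theorem abs_add_lt {t s : ℝ} (ht : |t - t₀| < r / 2) (hs : |s| < r / 2) : |t + s - t₀| < r := by
  rw [abs_lt] at *
  constructor <;> linarith

theorem injective_at (H : IsSheetChart ψ t₀ r h i) {t : ℝ} (ht : |t - t₀| < r / 2) {x : E3}
    (h0 : |x 0| < r / 2) (h1 : |x 1| < r / 2) (h2 : x 2 = 0)
    (he : ψ (t + x 0, x 1) = ψ (t, 0)) : x = 0 := by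
  have hr := H.pos
  obtain ⟨e1, e2⟩ := H.injective _ _ _ _ (abs_add_lt ht h0) (by linarith) (by linarith)
    (by simpa using hr) he
  ext j
  fin_cases j
  · simpa using e1
  · simpa using e2
  · simpa using h2

theorem chartMap_coord (H : IsSheetChart ψ t₀ r h i) (ε : ℝ) {t : ℝ} (ht : |t - t₀| < r / 2)
    {x : E3} (h0 : |x 0| < r / 2) (h1 : |x 1| < r / 2) :
    h (chartMap ψ h i ε t x) i = ε * x 2 := by
  rw [chartMap, H.apply_symm]
  have := H.coord_eq_zero (t + x 0) (x 1) (abs_add_lt ht h0) (by linarith [H.pos])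
  simp [this]

theorem chartMap_eq (H : IsSheetChart ψ t₀ r h i) (ε : ℝ) {t : ℝ} (ht : |t - t₀| < r / 2)
    {x : E3} (h0 : |x 0| < r / 2) (h1 : |x 1| < r / 2) (h2 : x 2 = 0) :
    chartMap ψ h i ε t x = ψ (t + x 0, x 1) := by
  rw [chartMap, h2]
  simp only [mul_zero, zero_smul, add_zero]
  exact h.left_inv (H.mem_source _ _ (abs_add_lt ht h0) (by linarith [H.pos]))

/-- The `i`-th chart coordinate of the value is `ε * x 2`, so the centre can only be hit from the
plane `x 2 = 0`, where the map is the injective parametrization. -/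
theorem chartMap_ne (H : IsSheetChart ψ t₀ r h i) {ε : ℝ} (hε : ε ≠ 0) {t : ℝ}
    (ht : |t - t₀| < r / 2) {x : E3} (h0 : |x 0| < r / 2) (h1 : |x 1| < r / 2) (hx : x ≠ 0) :
    chartMap ψ h i ε t x ≠ ψ (t, 0) := by
  intro he
  have hr := H.pos
  have h2 : x 2 = 0 := by
    have e1 := H.chartMap_coord ε ht h0 h1
    rw [he, H.coord_eq_zero _ _ (by linarith) (by simpa using hr)] at e1
    exact (mul_eq_zero.mp e1.symm).resolve_left hε
  rw [H.chartMap_eq ε ht h0 h1 h2] at he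
  exact hx (H.injective_at ht h0 h1 h2 he)

theorem continuousOn_chartMap (H : IsSheetChart ψ t₀ r h i) (ε : ℝ) :
    ContinuousOn (fun q : ℝ × E3 => chartMap ψ h i ε q.1 q.2)
      {q | |q.1 - t₀| < r / 2 ∧ |q.2 0| < r / 2 ∧ |q.2 1| < r / 2} := by
  have hc0 := continuous_coord 0
  have hc1 := continuous_coord 1
  have hc2 := continuous_coord 2
  have hψ : Continuous fun q : ℝ × E3 => ψ (q.1 + q.2 0, q.2 1) :=
    H.continuous.comp ((continuous_fst.add (hc0.comp continuous_snd)).prodMk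
      (hc1.comp continuous_snd))
  refine H.continuous_symm.comp_continuousOn (ContinuousOn.add ?_ ?_)
  · refine h.continuousOn.comp hψ.continuousOn ?_
    rintro q ⟨h1, h2, h3⟩
    exact H.mem_source _ _ (abs_add_lt h1 h2) (by linarith [H.pos])
  · exact ((continuous_const.mul (hc2.comp continuous_snd)).smul continuous_const).continuousOn

theorem abs_smul_lt {ρ : ℝ} (hρ : 0 < ρ) (hρr : ρ < r / 2) (x : Metric.sphere (0 : E3) 1)
    (j : Fin 3) : |(ρ • (x : E3)) j| < r / 2 := by
  rw [PiLp.smul_apply, smul_eq_mul, abs_mul, abs_of_pos hρ]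
  have := sphere_abs_le x j
  nlinarith

theorem abs_lt_of_mem {ρ : ℝ} (hρr : ρ < r / 2) {x : E3} (hx : x ∈ Metric.closedBall (0 : E3) ρ)
    (j : Fin 3) : |x j| < r / 2 := by
  have h1 : ‖x j‖ ≤ ‖x‖ := PiLp.norm_apply_le _ j
  rw [mem_closedBall_zero_iff] at hx
  rw [Real.norm_eq_abs] at h1
  linarith

/-- The base point and the radius are moved linearly; by `chartMap_ne` the centre is never hit on
the way. -/
theorem sphereHomotopic_chartGerm (H : IsSheetChart ψ t₀ r h i) {ε : ℝ} (hε : ε ≠ 0)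
    {t t' ρ ρ' : ℝ} (ht : |t - t₀| < r / 2) (ht' : |t' - t₀| < r / 2) (hρ : 0 < ρ)
    (hρr : ρ < r / 2) (hρ' : 0 < ρ') (hρr' : ρ' < r / 2) :
    SphereHomotopic (chartGerm ψ h i ε t ρ) (chartGerm ψ h i ε t' ρ') := by
  let T : unitInterval → ℝ := fun τ => (1 - (τ : ℝ)) * t + τ * t'
  let P : unitInterval → ℝ := fun τ => (1 - (τ : ℝ)) * ρ + τ * ρ'
  have hTc : Continuous T := by fun_prop
  have hPc : Continuous P := by fun_prop
  have hT : ∀ τ, |T τ - t₀| < r / 2 := by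
    intro τ
    rw [abs_lt] at *
    have h1 := mem_segment_pos (sub_pos.mpr ht.1) (sub_pos.mpr ht'.1) τ.2
    have h2 := mem_segment_pos (sub_pos.mpr ht.2) (sub_pos.mpr ht'.2) τ.2
    simp only [T]
    constructor <;> nlinarith
  have hP : ∀ τ, 0 < P τ := fun τ => mem_segment_pos hρ hρ' τ.2
  have hPr : ∀ τ, P τ < r / 2 := fun τ =>
    (mem_segment_le (le_max_left ρ ρ') (le_max_right ρ ρ') τ.2).trans_lt (max_lt hρr hρr')
  refine sphereHomotopic_of_unitInterval (K := fun q => chartGerm ψ h i ε (T q.1) (P q.1) q.2)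
    ?_ ?_ ?_ ?_
  · refine Continuous.sub ?_ (H.continuous.comp (by fun_prop))
    exact (H.continuousOn_chartMap ε).comp_continuous
      (f := fun q : unitInterval × Metric.sphere (0 : E3) 1 => (T q.1, P q.1 • (q.2 : E3)))
      (by fun_prop)
      (fun q => ⟨hT _, abs_smul_lt (hP _) (hPr _) _ _, abs_smul_lt (hP _) (hPr _) _ _⟩)
  · intro q
    exact sub_ne_zero.mpr (H.chartMap_ne hε (hT _) (abs_smul_lt (hP _) (hPr _) _ _)
      (abs_smul_lt (hP _) (hPr _) _ _) (smul_ne_zero (hP _).ne' (sphere_ne_zero _)))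
  · intro x
    simp [T, P]
  · intro x
    simp [T, P]

/-- The chart map with `ε = σ` works: its `i`-th coordinate is `σ * x 2`, and `σ * (σ * x 2) = x 2`,
so the sign of `x 2` decides the colour. -/
theorem exists_isSidedGerm (H : IsSheetChart ψ t₀ r h i) {Z A : Set E3} {σ : ℝ}
    (hσ : σ = 1 ∨ σ = -1) {t : ℝ} (ht : |t - t₀| < r / 2) (hs : HasSide Z A h i σ (ψ (t, 0))) :
    ∃ f, IsSidedGerm Z A ψ t f := by
  have hr := H.pos
  have hσσ : σ * σ = 1 := by rcases hσ with rfl | rfl <;> norm_num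
  have hσ0 : σ ≠ 0 := by rintro rfl; simp at hσσ
  have hc : ContinuousOn (chartMap ψ h i σ t) (Metric.closedBall 0 (r / 4)) :=
    (H.continuousOn_chartMap σ).comp (f := fun x => (t, x)) (by fun_prop) fun x hx =>
      ⟨ht, abs_lt_of_mem (by linarith) hx 0, abs_lt_of_mem (by linarith) hx 1⟩
  have h0 : chartMap ψ h i σ t 0 = ψ (t, 0) := by
    have := H.chartMap_eq σ ht (x := 0) (by simpa using by linarith) (by simpa using by linarith)
      (by simp)
    simpa using this
  have hc0 : ContinuousAt (chartMap ψ h i σ t) 0 :=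
    hc.continuousAt (Metric.closedBall_mem_nhds _ (by linarith))
  have hev := hc0.eventually (p := fun q => (q ∈ Z ↔ h q i = 0) ∧
    (q ∉ Z → (q ∈ A ↔ 0 < σ * h q i))) (by rw [h0]; exact hs)
  obtain ⟨η, hη, hev⟩ := Metric.eventually_nhds_iff_ball.mp hev
  set ρ := min (r / 4) (η / 2) with hρ
  have hρ0 : 0 < ρ := by positivity
  have hρr : ρ ≤ r / 4 := min_le_left _ _
  have hsub : ∀ x ∈ Metric.closedBall (0 : E3) ρ, x ∈ Metric.ball (0 : E3) η := fun x hx =>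
    Metric.closedBall_subset_ball ((min_le_right _ _).trans_lt (by linarith)) hx
  have hb : ∀ x ∈ Metric.closedBall (0 : E3) ρ, ∀ j, |x j| < r / 2 := fun x hx j =>
    abs_lt_of_mem (by linarith) hx j
  have hco : ∀ x ∈ Metric.closedBall (0 : E3) ρ, h (chartMap ψ h i σ t x) i = σ * x 2 :=
    fun x hx => H.chartMap_coord σ ht (hb x hx 0) (hb x hx 1)
  refine ⟨_, chartMap ψ h i σ t, ρ, hρ0, hc.mono (Metric.closedBall_subset_closedBall hρr),
    fun x hx h2 => H.chartMap_eq σ ht (hb x hx 0) (hb x hx 1) h2, fun x hx h2 => ?_,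
    fun x hx h2 => ?_, fun x hx hx0 => H.chartMap_ne hσ0 ht (hb x hx 0) (hb x hx 1) hx0,
    fun x => rfl⟩
  · obtain ⟨e1, e2⟩ := hev x (hsub x hx)
    rw [hco x hx] at e1 e2
    have hn : chartMap ψ h i σ t x ∉ Z := by
      rw [e1]
      exact mul_ne_zero hσ0 h2.ne'
    refine ⟨hn, (e2 hn).mpr ?_⟩
    rw [← mul_assoc, hσσ, one_mul]
    exact h2
  · obtain ⟨e1, e2⟩ := hev x (hsub x hx)
    rw [hco x hx] at e1 e2
    have hn : chartMap ψ h i σ t x ∉ Z := by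
      rw [e1]
      exact mul_ne_zero hσ0 h2.ne
    refine ⟨hn, fun hA => ?_⟩
    have := (e2 hn).mp hA
    rw [← mul_assoc, hσσ, one_mul] at this
    linarith

/-- Every sided germ is homotopic to the germ of a chart. -/
theorem sphereHomotopic_of_isSidedGerm (H : IsSheetChart ψ t₀ r h i) {Z A : Set E3} {σ : ℝ}
    (hσ : σ = 1 ∨ σ = -1) {t : ℝ} (ht : |t - t₀| < r / 2) (hs : HasSide Z A h i σ (ψ (t, 0)))
    {f : Metric.sphere (0 : E3) 1 → E3} (hf : IsSidedGerm Z A ψ t f) {ρ : ℝ} (hρ : 0 < ρ)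
    (hρr : ρ < r / 2) : SphereHomotopic f (chartGerm ψ h i σ t ρ) := by
  have hr := H.pos
  have hσσ : σ * σ = 1 := by rcases hσ with rfl | rfl <;> norm_num
  have hσ0 : σ ≠ 0 := by rintro rfl; simp at hσσ
  obtain ⟨F, ρ₁, hρ₁, hFc, hF0, hFpos, hFneg, hFne, hfF⟩ := hf
  have hsrc : ψ (t, 0) ∈ h.source := H.mem_source _ _ (by linarith) (by simpa using hr)
  have hF00 : F 0 = ψ (t, 0) := by
    have := hF0 0 (by simpa using hρ₁.le) (by simp)
    simpa using this
  have hFc0 : ContinuousAt F 0 := hFc.continuousAt (Metric.closedBall_mem_nhds _ hρ₁)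
  have hev := hFc0.eventually (p := fun q => ((q ∈ Z ↔ h q i = 0) ∧
    (q ∉ Z → (q ∈ A ↔ 0 < σ * h q i))) ∧ q ∈ h.source)
    (by rw [hF00]; exact hs.and (h.open_source.eventually_mem hsrc))
  obtain ⟨η, hη, hev⟩ := Metric.eventually_nhds_iff_ball.mp hev
  set ρ₂ := min (min ρ₁ (η / 2)) (r / 4) with hρ₂def
  have hρ₂ : 0 < ρ₂ := by positivity
  have hρ₂₁ : ρ₂ ≤ ρ₁ := (min_le_left _ _).trans (min_le_left _ _)
  have hρ₂η : ρ₂ ≤ η / 2 := (min_le_left _ _).trans (min_le_right _ _)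
  have hρ₂r : ρ₂ ≤ r / 4 := min_le_right _ _
  have step1 : SphereHomotopic f (fun x => F (ρ₂ • (x : E3)) - ψ (t, 0)) := by
    have : f = fun x : Metric.sphere (0 : E3) 1 => F (ρ₁ • (x : E3)) - ψ (t, 0) := funext hfF
    rw [this]
    exact sphereHomotopic_radius hρ₂ hρ₁ hρ₂₁ hFc hFne
  have hn : ∀ x : Metric.sphere (0 : E3) 1, ‖ρ₂ • (x : E3)‖ = ρ₂ := fun x => by
    rw [norm_smul, norm_eq_of_mem_sphere, mul_one, Real.norm_of_nonneg hρ₂.le]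
  have hm₁ : ∀ x : Metric.sphere (0 : E3) 1, ρ₂ • (x : E3) ∈ Metric.closedBall (0 : E3) ρ₁ :=
    fun x => by rw [mem_closedBall_zero_iff, hn]; exact hρ₂₁
  have hm₂ : ∀ x : Metric.sphere (0 : E3) 1, ρ₂ • (x : E3) ∈ Metric.ball (0 : E3) η :=
    fun x => by rw [mem_ball_zero_iff, hn]; linarith
  have hab : ∀ (x : Metric.sphere (0 : E3) 1) j, |(ρ₂ • (x : E3)) j| < r / 2 := fun x j =>
    abs_smul_lt hρ₂ (by linarith) x j
  have step2 : SphereHomotopic (fun x => F (ρ₂ • (x : E3)) - ψ (t, 0))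
      (chartGerm ψ h i σ t ρ₂) := by
    have hFx : Continuous fun x : Metric.sphere (0 : E3) 1 => F (ρ₂ • (x : E3)) :=
      hFc.comp_continuous (by fun_prop) hm₁
    have hhF : Continuous fun x : Metric.sphere (0 : E3) 1 => h (F (ρ₂ • (x : E3))) :=
      h.continuousOn.comp_continuous hFx fun x => (hev _ (hm₂ x)).2
    have hCx : Continuous fun x : Metric.sphere (0 : E3) 1 => chartMap ψ h i σ t (ρ₂ • (x : E3)) :=
      (H.continuousOn_chartMap σ).comp_continuous
        (f := fun x : Metric.sphere (0 : E3) 1 => (t, ρ₂ • (x : E3))) (by fun_prop)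
        fun x => ⟨ht, hab x 0, hab x 1⟩
    have hhC : Continuous fun x : Metric.sphere (0 : E3) 1 =>
        h (chartMap ψ h i σ t (ρ₂ • (x : E3))) :=
      h.continuousOn.comp_continuous hCx fun x => H.symm_mem _
    -- This is the straight-line homotopy in the chart. Off the equator both ends lie strictly on
    -- the same side of the sheet, so the segment misses the sheet. On the equator both ends are the
    -- same value of `ψ`, different from the centre.
    refine sphereHomotopic_of_unitInterval (K := fun q => h.symm ((1 - (q.1 : ℝ)) •
      h (F (ρ₂ • (q.2 : E3))) + (q.1 : ℝ) • h (chartMap ψ h i σ t (ρ₂ • (q.2 : E3)))) - ψ (t, 0))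
      ?_ ?_ ?_ ?_
    · refine (H.continuous_symm.comp ?_).sub continuous_const
      have h1 := hhF.comp (continuous_snd (X := unitInterval))
      have h2 := hhC.comp (continuous_snd (X := unitInterval))
      have h3 : Continuous fun q : unitInterval × Metric.sphere (0 : E3) 1 => (q.1 : ℝ) := by fun_prop
      exact ((continuous_const.sub h3).fun_smul h1).add (h3.fun_smul h2)
    · rintro ⟨τ, x⟩
      rw [sub_ne_zero]
      intro he
      dsimp only at he
      have hq := congrArg h he
      rw [H.apply_symm] at hq
      have hqi := congrArg (fun y : E3 => σ * y i) hq
      simp only [PiLp.add_apply, PiLp.smul_apply, smul_eq_mul] at hqi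
      rw [H.chartMap_coord σ ht (hab x 0) (hab x 1),
        H.coord_eq_zero _ _ (by linarith) (by simpa using hr)] at hqi
      obtain ⟨⟨e1, e2⟩, e3⟩ := hev _ (hm₂ x)
      rcases lt_trichotomy ((ρ₂ • (x : E3)) 2) 0 with hneg | hzero | hpos
      · obtain ⟨k1, k2⟩ := hFneg _ (hm₁ x) hneg
        have k3 : σ * h (F (ρ₂ • (x : E3))) i < 0 := by
          refine lt_of_le_of_ne (not_lt.mp fun hlt => k2 ((e2 k1).mpr hlt)) ?_
          exact mul_ne_zero hσ0 (fun h0 => k1 (e1.mpr h0))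
        have := mem_segment_pos (neg_pos.mpr k3) (neg_pos.mpr hneg) τ.2
        have hsq : σ * (σ * (ρ₂ • (x : E3)) 2) = (ρ₂ • (x : E3)) 2 := by
          rw [← mul_assoc, hσσ, one_mul]
        have hz : (1 - (τ : ℝ)) * (σ * h (F (ρ₂ • (x : E3))) i) + τ * (ρ₂ • (x : E3)) 2 = 0 := by
          linear_combination hqi - (τ : ℝ) * hsq
        linarith
      · have hFe : F (ρ₂ • (x : E3)) = ψ (t + (ρ₂ • (x : E3)) 0, (ρ₂ • (x : E3)) 1) :=
          hF0 _ (hm₁ x) hzero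
        rw [H.chartMap_eq σ ht (hab x 0) (hab x 1) hzero, ← hFe, ← add_smul, sub_add_cancel,
          one_smul, h.left_inv e3] at he
        exact hFne _ (hm₁ x) (smul_ne_zero hρ₂.ne' (sphere_ne_zero x)) he
      · obtain ⟨k1, k2⟩ := hFpos _ (hm₁ x) hpos
        have k3 := (e2 k1).mp k2
        have := mem_segment_pos k3 hpos τ.2
        have hsq : σ * (σ * (ρ₂ • (x : E3)) 2) = (ρ₂ • (x : E3)) 2 := by
          rw [← mul_assoc, hσσ, one_mul]
        have hz : (1 - (τ : ℝ)) * (σ * h (F (ρ₂ • (x : E3))) i) + τ * (ρ₂ • (x : E3)) 2 = 0 := by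
          linear_combination hqi - (τ : ℝ) * hsq
        linarith
    · intro x
      simp only [Icc.coe_zero, sub_zero, one_smul, zero_smul, add_zero]
      rw [h.left_inv (hev _ (hm₂ x)).2]
    · intro x
      simp only [Icc.coe_one, sub_self, one_smul, zero_smul, zero_add]
      rw [h.left_inv (show chartMap ψ h i σ t (ρ₂ • (x : E3)) ∈ h.source from H.symm_mem _)]
      rfl
  exact step1.trans (step2.trans (H.sphereHomotopic_chartGerm hσ0 ht ht hρ₂ (by linarith) hρ hρr))

/-- The germ of a chart that is onto a neighbourhood is not homotopic to its reflection. -/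
theorem not_sphereHomotopic_reflect (H : IsSheetChart ψ t₀ r h i)
    (hopen : ∀ δ > 0, ∀ᶠ q in 𝓝 (ψ (t₀, 0)), h q i = 0 →
      ∃ s v, |s - t₀| < δ ∧ |v| < δ ∧ ψ (s, v) = q)
    {ρ : ℝ} (hρ : 0 < ρ) (hρr : ρ < r / 2) :
    ¬ SphereHomotopic (chartGerm ψ h i 1 t₀ ρ) (chartGerm ψ h i 1 t₀ ρ ∘ sphereReflect) := by
  have hr := H.pos
  have ht : |t₀ - t₀| < r / 2 := by simpa using hr
  have h0 : chartMap ψ h i 1 t₀ 0 = ψ (t₀, 0) := by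
    have := H.chartMap_eq 1 ht (x := 0) (by simpa using hr) (by simpa using hr) (by simp)
    simpa using this
  have hsrc : ψ (t₀, 0) ∈ h.source := H.mem_source _ _ (by linarith) (by simpa using hr)
  have hc : ContinuousOn (chartMap ψ h i 1 t₀) (Metric.closedBall 0 ρ) :=
    (H.continuousOn_chartMap 1).comp (f := fun x => (t₀, x)) (by fun_prop) fun x hx =>
      ⟨ht, abs_lt_of_mem hρr hx 0, abs_lt_of_mem hρr hx 1⟩
  have hinj : InjOn (chartMap ψ h i 1 t₀) (Metric.closedBall 0 ρ) := by
    intro x hx y hy hxy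
    have b := fun j => abs_lt_of_mem hρr hx j
    have b' := fun j => abs_lt_of_mem hρr hy j
    have e2 : x 2 = y 2 := by
      have h1 := H.chartMap_coord 1 ht (b 0) (b 1)
      rw [hxy, H.chartMap_coord 1 ht (b' 0) (b' 1)] at h1
      linarith
    have he := congrArg h hxy
    rw [chartMap, chartMap, H.apply_symm, H.apply_symm, e2, add_left_inj] at he
    have hm := H.mem_source _ _ (abs_add_lt ht (b 0)) (show |x 1| < r by linarith [b 1])
    have hm' := H.mem_source _ _ (abs_add_lt ht (b' 0)) (show |y 1| < r by linarith [b' 1])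
    obtain ⟨k1, k2⟩ := H.injective _ _ _ _ (abs_add_lt ht (b 0)) (by linarith [b 1])
      (abs_add_lt ht (b' 0)) (by linarith [b' 1]) (h.injOn hm hm' he)
    ext j
    fin_cases j
    · simpa using k1
    · exact k2
    · exact e2
  have hnhds : chartMap ψ h i 1 t₀ '' Metric.closedBall 0 ρ ∈ 𝓝 (chartMap ψ h i 1 t₀ 0) := by
    rw [h0]
    have hhc := h.continuousAt hsrc
    have hhi : ContinuousAt (fun q => h q i) (ψ (t₀, 0)) :=
      (continuous_coord i).continuousAt.comp hhc
    have hi0 : h (ψ (t₀, 0)) i = 0 := H.coord_eq_zero _ _ (by linarith) (by simpa using hr)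
    -- `π` projects to the sheet along the `i`-th chart axis. A preimage of `q` consists of the
    -- surface parameters of `π q` and the height of `q`; bounding all three by `ρ / 3` keeps it in
    -- the ball.
    let π : E3 → E3 := fun q => h.symm (h q - h q i • EuclideanSpace.single i 1)
    have hπ : ContinuousAt π (ψ (t₀, 0)) :=
      H.continuous_symm.continuousAt.comp (hhc.sub (hhi.smul continuousAt_const))
    have hπ0 : π (ψ (t₀, 0)) = ψ (t₀, 0) := by
      simp [π, hi0, h.left_inv hsrc]
    have hev := hπ.eventually (p := fun q => h q i = 0 →
      ∃ s v, |s - t₀| < ρ / 3 ∧ |v| < ρ / 3 ∧ ψ (s, v) = q) (by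
        rw [hπ0]
        exact hopen (ρ / 3) (by positivity))
    have hsm : ∀ᶠ q in 𝓝 (ψ (t₀, 0)), |h q i| < ρ / 3 :=
      hhi.abs.eventually_lt continuousAt_const (by rw [hi0]; simpa using by positivity)
    filter_upwards [hev, hsm, h.open_source.eventually_mem hsrc] with q hq1 hq2 hq3
    obtain ⟨s, v, hs, hv, hψ⟩ := hq1 (by simp [π, H.apply_symm])
    refine ⟨!₂[s - t₀, v, h q i], ?_, ?_⟩
    · rw [mem_closedBall_zero_iff]
      have : ‖(!₂[s - t₀, v, h q i] : E3)‖ ^ 2 ≤ ρ ^ 2 := by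
        rw [EuclideanSpace.norm_sq_eq, Fin.sum_univ_three]
        simp only [Matrix.cons_val_zero, Matrix.cons_val_one, Matrix.cons_val, Real.norm_eq_abs]
        have a1 := abs_nonneg (s - t₀)
        have a2 := abs_nonneg v
        have a3 := abs_nonneg (h q i)
        nlinarith
      exact le_of_sq_le_sq this hρ.le
    · rw [chartMap]
      simp only [Matrix.cons_val_zero, Matrix.cons_val_one, Matrix.cons_val, add_sub_cancel,
        one_mul]
      rw [hψ, H.apply_symm, sub_add_cancel, h.left_inv hq3]
  have := not_sphereHomotopic_of_injOn hρ hc hinj hnhds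
  rw [h0] at this
  exact this

end IsSheetChart

end SurfaceImmersion

/-! ### The singular set on a sheet and sign changes at crossings -/

namespace SurfaceImmersion

open Set Filter Topology

variable {S : Type*} [TopologicalSpace S]

/-- The product of those of the first `k` coordinates that are different from the `i`-th one. -/
noncomputable def otherProd {k : ℕ} (hk : k ≤ 3) (i : Fin k) (y : E3) : ℝ :=
  ∏ j ∈ Finset.univ.erase i, y (Fin.castLE hk j)

theorem continuous_otherProd {k : ℕ} (hk : k ≤ 3) (i : Fin k) : Continuous (otherProd hk i) :=
  continuous_finsetProd _ fun _ _ => continuous_coord _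

theorem coordProd_eq {k : ℕ} (hk : k ≤ 3) (i : Fin k) (y : E3) :
    coordProd hk y = y (Fin.castLE hk i) * otherProd hk i y :=
  (Finset.mul_prod_erase _ _ (Finset.mem_univ i)).symm

namespace IsNormalChart

variable {φ : S → E3} {p : E3} {k : ℕ} {hk : k ≤ 3} {h : OpenPartialHomeomorph E3 E3}
  {U : Fin k → Set S}

/-- On the `i`-th sheet the `i`-th coordinate already vanishes, so a further preimage means that
another sheet coordinate vanishes. -/
theorem mem_singularSet_iff (H : IsNormalChart φ p hk h U) {i : Fin k} {x : S} (hx : x ∈ U i) :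
    x ∈ singularSet φ ↔ otherProd hk i (h (φ x)) = 0 := by
  obtain ⟨hs, hi⟩ := H.map_sheet hx
  rw [singularSet, mem_preimage, doubleSet, mem_ofPred_eq, H.encard_preimage hs,
    one_lt_encard_iff, otherProd, Finset.prod_eq_zero_iff]
  constructor
  · rintro ⟨a, b, ha, hb, hab⟩
    by_cases hai : a = i
    · exact ⟨b, by simpa [← hai] using hab.symm, hb⟩
    · exact ⟨a, by simpa using hai, ha⟩
  · rintro ⟨j, hj, h0⟩
    exact ⟨j, i, h0, hi, Finset.ne_of_mem_erase hj⟩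

theorem encard_preimage_centre (H : IsNormalChart φ p hk h U) : (φ ⁻¹' {p}).encard = k := by
  rw [H.encard_preimage H.mem_source, H.map_eq_zero]
  simp

/-- Points of the sheet `U i` whose images are close to `φ x₀` are close to `x₀`. -/
theorem eventually_exists_mem_sheet (H : IsNormalChart φ p hk h U) {i : Fin k} {x₀ : S}
    (hx₀ : x₀ ∈ U i) {V : Set S} (hV : V ∈ 𝓝 x₀) :
    ∀ᶠ q in 𝓝 (φ x₀), h q (Fin.castLE hk i) = 0 → ∃ x ∈ V, x ∈ U i ∧ φ x = q := by
  have hmem : ((↑) : U i → S) ⁻¹' V ∈ 𝓝 (⟨x₀, hx₀⟩ : U i) :=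
    continuous_subtype_val.continuousAt.preimage_mem_nhds hV
  rw [(H.isEmbedding i).isInducing.nhds_eq_comap, mem_comap] at hmem
  obtain ⟨W, hW, hWV⟩ := hmem
  filter_upwards [hW, h.open_source.eventually_mem (H.map_sheet hx₀).1] with q hq hs h0
  obtain ⟨x, hx, rfl⟩ := H.exists_mem_sheet hs h0
  exact ⟨x, hWV (show (⟨x, hx⟩ : U i) ∈ _ from hq), hx, rfl⟩

/-- At a double point the other coordinate takes both signs on the sheet. -/
theorem frequently_otherProd_pos (H : IsNormalChart φ p hk h U) (i : Fin k)
    (hcard : (Finset.univ.erase i).card = 1) {d : ℝ} (hd : d ≠ 0) :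
    ∃ᶠ q in 𝓝 p, h q (Fin.castLE hk i) = 0 ∧ 0 < d * otherProd hk i (h q) := by
  obtain ⟨j, hj⟩ := Finset.card_eq_one.mp hcard
  have hji : j ≠ i := by
    have : j ∈ Finset.univ.erase i := hj ▸ Finset.mem_singleton_self j
    exact Finset.ne_of_mem_erase this
  have htend : Tendsto (fun s : ℝ => h.symm (s • EuclideanSpace.single (Fin.castLE hk j) 1))
      (𝓝 0) (𝓝 p) := by
    have : Continuous fun s : ℝ => h.symm (s • EuclideanSpace.single (Fin.castLE hk j) 1) :=
      H.continuous_symm.comp (by fun_prop)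
    have h2 := this.tendsto 0
    simpa [H.symm_zero] using h2
  have hfreq : ∃ᶠ s in 𝓝 (0 : ℝ), 0 < d * s := by
    rcases lt_or_gt_of_ne hd with hd | hd
    · exact (frequently_lt_nhds (0 : ℝ)).mono fun s hs => mul_pos_of_neg_of_neg hd hs
    · exact (frequently_gt_nhds (0 : ℝ)).mono fun s hs => mul_pos hd hs
  refine htend.frequently (hfreq.mono fun s hs => ?_)
  rw [H.apply_symm, otherProd, hj, Finset.prod_singleton]
  have : Fin.castLE hk i ≠ Fin.castLE hk j := fun h => hji (Fin.castLE_injective hk h).symm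
  simpa [this] using hs

/-- Near a point of a sheet that lies on no other sheet, the colouring is given by the side of
the sheet. -/
theorem hasSide (H : IsNormalChart φ p hk h U) {A : Set E3} {σ₀ : ℝ} (i : Fin k) {q₀ : E3}
    (hq₀ : q₀ ∈ h.source)
    (hA : ∀ᶠ q in 𝓝 q₀, q ∉ range φ → (q ∈ A ↔ 0 < σ₀ * coordProd hk (h q))) {σ : ℝ}
    (hσ : 0 < σ * (σ₀ * otherProd hk i (h q₀))) :
    HasSide (range φ) A h (Fin.castLE hk i) σ q₀ := by
  have hc : ContinuousAt (fun q => σ * (σ₀ * otherProd hk i (h q))) q₀ :=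
    continuousAt_const.mul (continuousAt_const.mul
      ((continuous_otherProd hk i).continuousAt.comp (h.continuousAt hq₀)))
  filter_upwards [hA, h.open_source.eventually_mem hq₀,
    continuousAt_const.eventually_lt hc hσ] with q h1 h2 h3
  have hM : otherProd hk i (h q) ≠ 0 := by
    intro h0
    simp [h0] at h3
  refine ⟨?_, fun hr => ?_⟩
  · rw [H.mem_range_iff h2, coordProd_eq hk i, mul_eq_zero, or_iff_left hM]
  · rw [h1 hr, coordProd_eq hk i]
    set c := σ₀ * otherProd hk i (h q)
    set y := h q (Fin.castLE hk i)
    have e : σ₀ * (y * otherProd hk i (h q)) = c * y := by ring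
    rw [e]
    -- Since `σ * c` is positive, `c * y` and `σ * y` have the same sign off the sheet.
    have hpos : (c * y) * (σ * y) = (σ * c) * (y * y) := by ring
    constructor
    · intro h4
      have hy : y ≠ 0 := by rintro h5; simp [h5] at h4
      have h6 : 0 < (c * y) * (σ * y) := by
        rw [hpos]
        exact mul_pos h3 (mul_self_pos.mpr hy)
      exact (pos_iff_pos_of_mul_pos h6).mp h4
    · intro h4
      have hy : y ≠ 0 := by rintro h5; simp [h5] at h4
      have h6 : 0 < (c * y) * (σ * y) := by
        rw [hpos]
        exact mul_pos h3 (mul_self_pos.mpr hy)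
      exact (pos_iff_pos_of_mul_pos h6).mpr h4

end IsNormalChart

/-- An injective continuous real function changes sign at its zero. -/
theorem exists_sign_change {u : ℝ → ℝ} {t₀ δ : ℝ} (hδ : 0 < δ)
    (hc : ContinuousOn u (Icc (t₀ - δ) (t₀ + δ))) (hi : InjOn u (Icc (t₀ - δ) (t₀ + δ)))
    (h0 : u t₀ = 0) : ∃ s : ℝ, (s = 1 ∨ s = -1) ∧
      (∀ᶠ t in 𝓝[>] t₀, 0 < s * u t) ∧ ∀ᶠ t in 𝓝[<] t₀, s * u t < 0 := by
  have hr : ∀ᶠ t in 𝓝[>] t₀, t₀ < t ∧ t ∈ Icc (t₀ - δ) (t₀ + δ) := by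
    filter_upwards [Ioo_mem_nhdsGT (show t₀ < t₀ + δ by linarith)] with t ht
    exact ⟨ht.1, by linarith [ht.1], ht.2.le⟩
  have hl : ∀ᶠ t in 𝓝[<] t₀, t < t₀ ∧ t ∈ Icc (t₀ - δ) (t₀ + δ) := by
    filter_upwards [Ioo_mem_nhdsLT (show t₀ - δ < t₀ by linarith)] with t ht
    exact ⟨ht.2, ht.1.le, by linarith [ht.2]⟩
  have hm : t₀ ∈ Icc (t₀ - δ) (t₀ + δ) := ⟨by linarith, by linarith⟩
  rcases le_total (u (t₀ - δ)) (u (t₀ + δ)) with hle | hle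
  · have hmono := hc.strictMonoOn_of_injOn_Icc (by linarith) hle hi
    refine ⟨1, Or.inl rfl, ?_, ?_⟩
    · filter_upwards [hr] with t ht
      have := hmono hm ht.2 ht.1
      linarith
    · filter_upwards [hl] with t ht
      have := hmono ht.2 hm ht.1
      linarith
  · have hanti := hc.strictAntiOn_of_injOn_Icc (by linarith) hle hi
    refine ⟨-1, Or.inr rfl, ?_, ?_⟩
    · filter_upwards [hr] with t ht
      have := hanti hm ht.2 ht.1
      linarith
    · filter_upwards [hl] with t ht
      have := hanti ht.2 hm ht.1
      linarith

/-- A continuous function without zeros on a preconnected set has constant sign. -/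
theorem exists_sign_of_isPreconnected {X : Type*} [TopologicalSpace X] {s : Set X}
    (hs : IsPreconnected s) {f : X → ℝ} (hf : ContinuousOn f s) (h0 : ∀ x ∈ s, f x ≠ 0) :
    ∃ d : ℝ, (d = 1 ∨ d = -1) ∧ ∀ x ∈ s, 0 < d * f x := by
  by_cases h : ∃ x ∈ s, f x < 0
  · obtain ⟨x, hx, hfx⟩ := h
    refine ⟨-1, Or.inr rfl, fun y hy => ?_⟩
    by_contra hn
    obtain ⟨z, hz, hz0⟩ := hs.intermediate_value hx hy hf
      (show (0 : ℝ) ∈ Icc (f x) (f y) from ⟨hfx.le, by linarith⟩)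
    exact h0 z hz hz0
  · push Not at h
    refine ⟨1, Or.inl rfl, fun y hy => ?_⟩
    rw [one_mul]
    exact lt_of_le_of_ne (h y hy) (h0 y hy).symm

/-- Where a curve crosses the other sheet transversally at a double point, the coordinate defining
this sheet changes sign along the curve. -/
theorem exists_sign_change_otherProd {φ : S → E3} (hφ : Continuous φ) {k : ℕ} {hk : k ≤ 3}
    {h : OpenPartialHomeomorph E3 E3} {U : Fin k → Set S} {c : ℝ → S} (hc : Continuous c)
    {t₀ : ℝ} (H : IsNormalChart φ (φ (c t₀)) hk h U) {i : Fin k} (hi : c t₀ ∈ U i)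
    (hcard : (Finset.univ.erase i).card = 1)
    (hinj : ∀ᶠ δ in 𝓝[>] (0 : ℝ), InjOn c (Icc (t₀ - δ) (t₀ + δ)))
    (htr : CrossTransversallyAt (range c) (singularSet φ) (c t₀)) :
    ∃ s : ℝ, (s = 1 ∨ s = -1) ∧ (∀ᶠ t in 𝓝[>] t₀, 0 < s * otherProd hk i (h (φ (c t)))) ∧
      ∀ᶠ t in 𝓝[<] t₀, s * otherProd hk i (h (φ (c t))) < 0 := by
  obtain ⟨g, hgs, hg0, hgt, hgC, hgD⟩ := htr
  have hgsymm : Continuous g.symm := by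
    have := g.continuousOn_symm
    rwa [hgt, continuousOn_univ] at this
  have hgm : ∀ y, g.symm y ∈ g.source := fun y => g.map_target (hgt ▸ mem_univ y)
  have hgr : ∀ y, g (g.symm y) = y := fun y => g.right_inv (hgt ▸ mem_univ y)
  have hg00 : g.symm 0 = c t₀ := by rw [← hg0, g.left_inv hgs]
  have hcoord : ∀ a : Fin 2, Continuous fun y : E2 => y a := fun a =>
    (EuclideanSpace.proj a : E2 →L[ℝ] ℝ).continuous
  obtain ⟨ε, hε, hball⟩ : ∃ ε > 0, ∀ y ∈ Metric.ball (0 : E2) ε, g.symm y ∈ U i := by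
    refine Metric.eventually_nhds_iff_ball.mp (hgsymm.continuousAt.eventually_mem ?_)
    rw [hg00]
    exact (H.isOpen i).mem_nhds hi
  let f : E2 → ℝ := fun y => otherProd hk i (h (φ (g.symm y)))
  have hfc : ContinuousOn f (Metric.ball 0 ε) :=
    (continuous_otherProd hk i).comp_continuousOn
      (h.continuousOn.comp (hφ.comp hgsymm).continuousOn fun y hy => (H.map_sheet (hball y hy)).1)
  have hf0 : ∀ y ∈ Metric.ball (0 : E2) ε, f y = 0 ↔ y 1 = 0 := by
    intro y hy
    rw [← H.mem_singularSet_iff (hball y hy), hgD _ (hgm y), hgr]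
  have hhalf : ∀ a : ℝ, IsPreconnected (Metric.ball (0 : E2) ε ∩ {y | 0 < a * y 1}) := by
    intro a
    refine ((convex_ball _ _).inter ?_).isPreconnected
    exact (convex_Ioi (0 : ℝ)).linear_preimage
      ((a • (EuclideanSpace.proj 1 : E2 →L[ℝ] ℝ)).toLinearMap)
  -- In the surface chart the other coordinate vanishes only on the axis `y 1 = 0`, so it has
  -- constant sign on each open half disc.
  have hsgn : ∀ a : ℝ, ∃ d : ℝ, (d = 1 ∨ d = -1) ∧
      ∀ y ∈ Metric.ball (0 : E2) ε ∩ {y | 0 < a * y 1}, 0 < d * f y := by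
    intro a
    refine exists_sign_of_isPreconnected (hhalf a) (hfc.mono inter_subset_left) ?_
    rintro y ⟨hy, hy1⟩ h0
    rw [hf0 y hy] at h0
    simp [h0] at hy1
  obtain ⟨d₁, hd₁, hp⟩ := hsgn 1
  obtain ⟨d₂, hd₂, hn⟩ := hsgn (-1)
  -- If the two half discs had equal signs, the other coordinate would not take the opposite sign on
  -- the sheet near the double point, contrary to `frequently_otherProd_pos`.
  have hdd : d₂ = -d₁ := by
    by_contra hne
    have hdd : d₂ = d₁ := by
      rcases hd₁ with rfl | rfl <;> rcases hd₂ with rfl | rfl <;>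
        first | rfl | exact absurd (by norm_num) hne
    have hd0 : d₁ ≠ 0 := by rcases hd₁ with rfl | rfl <;> norm_num
    have hV : {x | x ∈ g.source ∧ g x ∈ Metric.ball (0 : E2) ε} ∈ 𝓝 (c t₀) := by
      refine (g.open_source.eventually_mem hgs).and
        ((g.continuousAt hgs).eventually_mem ?_)
      rw [hg0]
      exact Metric.ball_mem_nhds _ hε
    obtain ⟨q, ⟨hq1, hq2⟩, hq3⟩ := ((H.frequently_otherProd_pos i hcard
      (neg_ne_zero.mpr hd0)).and_eventually (H.eventually_exists_mem_sheet hi hV)).exists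
    obtain ⟨x, ⟨hxs, hxb⟩, hxU, rfl⟩ := hq3 hq1
    have hfx : f (g x) = otherProd hk i (h (φ x)) := by simp only [f, g.left_inv hxs]
    rw [← hfx] at hq2
    rcases lt_trichotomy (g x 1) 0 with h1 | h1 | h1
    · have := hn (g x) ⟨hxb, by simpa using h1⟩
      rw [hdd] at this
      linarith
    · rw [(hf0 _ hxb).mpr h1] at hq2
      simp at hq2
    · have := hp (g x) ⟨hxb, by simpa using h1⟩
      linarith
  obtain ⟨δ, hδ, hδi, hδs⟩ : ∃ δ > 0, InjOn c (Icc (t₀ - δ) (t₀ + δ)) ∧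
      ∀ t ∈ Icc (t₀ - δ) (t₀ + δ), c t ∈ g.source ∧ g (c t) ∈ Metric.ball (0 : E2) ε := by
    have hev : ∀ᶠ t in 𝓝 t₀, c t ∈ g.source ∧ g (c t) ∈ Metric.ball (0 : E2) ε := by
      refine (hc.continuousAt.eventually_mem (g.open_source.mem_nhds hgs)).and ?_
      refine ((g.continuousAt hgs).comp hc.continuousAt).eventually_mem ?_
      rw [Function.comp_apply, hg0]
      exact Metric.ball_mem_nhds _ hε
    obtain ⟨η, hη, hev⟩ := Metric.eventually_nhds_iff_ball.mp hev
    obtain ⟨δ, hδi, hδ0, hδη⟩ := (hinj.and (Ioo_mem_nhdsGT hη)).exists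
    refine ⟨δ, hδ0, hδi, fun t ht => hev t ?_⟩
    rw [Real.ball_eq_Ioo]
    exact ⟨by linarith [ht.1], by linarith [ht.2]⟩
  have hucont : ContinuousOn (fun t => g (c t) 1) (Icc (t₀ - δ) (t₀ + δ)) :=
    (hcoord 1).comp_continuousOn (g.continuousOn.comp hc.continuousOn fun t ht => (hδs t ht).1)
  -- The curve runs inside the axis where the coordinate `0` vanishes, so its coordinate `1` alone
  -- determines the point. Being injective and continuous, that coordinate changes sign, and the
  -- curve passes from one half disc to the other.
  have huinj : InjOn (fun t => g (c t) 1) (Icc (t₀ - δ) (t₀ + δ)) := by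
    intro t ht t' ht' he
    have hz : ∀ t ∈ Icc (t₀ - δ) (t₀ + δ), g (c t) 0 = 0 := fun t ht =>
      (hgC _ (hδs t ht).1).mp (mem_range_self t)
    have : g (c t) = g (c t') := by
      ext a
      fin_cases a
      · exact (hz t ht).trans (hz t' ht').symm
      · exact he
    exact hδi ht ht' (g.injOn (hδs t ht).1 (hδs t' ht').1 this)
  obtain ⟨s, hs, hgt', hlt'⟩ := exists_sign_change hδ hucont huinj (by simp [hg0])
  have hmemδ : ∀ᶠ t in 𝓝 t₀, t ∈ Icc (t₀ - δ) (t₀ + δ) :=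
    Icc_mem_nhds (by linarith) (by linarith)
  have hfeq : ∀ t ∈ Icc (t₀ - δ) (t₀ + δ), f (g (c t)) = otherProd hk i (h (φ (c t))) := by
    intro t ht
    simp only [f, g.left_inv (hδs t ht).1]
  have hboth : ∀ t ∈ Icc (t₀ - δ) (t₀ + δ), (0 < g (c t) 1 → 0 < d₁ * otherProd hk i (h (φ (c t)))) ∧
      (g (c t) 1 < 0 → d₁ * otherProd hk i (h (φ (c t))) < 0) := by
    intro t ht
    rw [← hfeq t ht]
    refine ⟨fun h1 => hp _ ⟨(hδs t ht).2, by simpa using h1⟩, fun h1 => ?_⟩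
    have := hn _ ⟨(hδs t ht).2, by simpa using h1⟩
    rw [hdd] at this
    linarith
  refine ⟨s * d₁, ?_, ?_, ?_⟩
  · rcases hs with rfl | rfl <;> rcases hd₁ with rfl | rfl <;> norm_num
  · filter_upwards [hgt', hmemδ.filter_mono nhdsWithin_le_nhds] with t ht hm
    obtain ⟨b1, b2⟩ := hboth t hm
    rcases hs with rfl | rfl
    · have := b1 (by linarith)
      linarith
    · have := b2 (by linarith)
      linarith
  · filter_upwards [hlt', hmemδ.filter_mono nhdsWithin_le_nhds] with t ht hm
    obtain ⟨b1, b2⟩ := hboth t hm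
    rcases hs with rfl | rfl
    · have := b2 (by linarith)
      linarith
    · have := b1 (by linarith)
      linarith

end SurfaceImmersion

/-! ### Sided germs along the curve, locally -/

namespace SurfaceImmersion

open Set Filter Topology

/-- The number of elements of `D` between `a` and `t`, as a function of `t`, is locally constant
except for jumps by one at the elements of `D`. -/
theorem eventually_ncard_inter_Icc {D : Set ℝ} {a b t₀ : ℝ} (ha : a ∉ D) (hat : a ≤ t₀)
    (htb : t₀ < b) (hD : (D ∩ Icc a b).Finite) :
    (∀ᶠ t in 𝓝[>] t₀, t ∉ D) ∧
    (∀ᶠ t in 𝓝[>] t₀, (D ∩ Icc a t).ncard = (D ∩ Icc a t₀).ncard) ∧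
    (t₀ ∉ D → ∀ᶠ t in 𝓝[<] t₀, (D ∩ Icc a t).ncard = (D ∩ Icc a t₀).ncard) ∧
    (t₀ ∈ D → ∀ᶠ t in 𝓝[<] t₀, (D ∩ Icc a t).ncard + 1 = (D ∩ Icc a t₀).ncard) := by
  have hF : ((D ∩ Icc a b) \ {t₀}).Finite := hD.subset sdiff_subset
  have hnF : ((D ∩ Icc a b) \ {t₀})ᶜ ∈ 𝓝 t₀ := hF.isClosed.isOpen_compl.mem_nhds (by simp)
  obtain ⟨δ, hδ, hball⟩ := Metric.mem_nhds_iff.mp hnF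
  have hiso : ∀ u ∈ D, a ≤ u → u ≤ b → t₀ - δ < u → u < t₀ + δ → u = t₀ := by
    intro u hu hau hub h1 h2
    by_contra hne
    have hub' : u ∈ Metric.ball t₀ δ := by
      rw [Real.ball_eq_Ioo]
      exact ⟨h1, h2⟩
    exact hball hub' ⟨⟨hu, hau, hub⟩, hne⟩
  have hr : ∀ᶠ t in 𝓝[>] t₀, t ∈ Ioo t₀ (min b (t₀ + δ)) :=
    Ioo_mem_nhdsGT (lt_min htb (by linarith))
  have hl : ∀ᶠ t in 𝓝[<] t₀, t ∈ Ioo (t₀ - δ) t₀ := Ioo_mem_nhdsLT (by linarith)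
  refine ⟨?_, ?_, fun h0 => ?_, fun h0 => ?_⟩
  · filter_upwards [hr] with t ht hD
    have h1 := ht.2.trans_le (min_le_left _ _)
    have h2 := ht.2.trans_le (min_le_right _ _)
    exact ht.1.ne' (hiso t hD (hat.trans ht.1.le) h1.le (by linarith [ht.1]) h2)
  · filter_upwards [hr] with t ht
    have h1 := ht.2.trans_le (min_le_left _ _)
    have h2 := ht.2.trans_le (min_le_right _ _)
    congr 1
    ext u
    refine ⟨fun ⟨hu, hau, hut⟩ => ⟨hu, hau, ?_⟩, fun ⟨hu, hau, hut⟩ => ⟨hu, hau, hut.trans ht.1.le⟩⟩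
    by_contra! hlt
    exact hlt.ne' (hiso u hu hau (hut.trans h1.le) (by linarith) (hut.trans_lt h2))
  · filter_upwards [hl] with t ht
    congr 1
    ext u
    refine ⟨fun ⟨hu, hau, hut⟩ => ⟨hu, hau, hut.trans ht.2.le⟩, fun ⟨hu, hau, hut⟩ => ⟨hu, hau, ?_⟩⟩
    by_contra! hlt
    have := hiso u hu hau (hut.trans htb.le) (by linarith [ht.1]) (by linarith)
    exact h0 (this ▸ hu)
  · have hat' : a < t₀ := lt_of_le_of_ne hat fun h => ha (h ▸ h0)
    filter_upwards [hl, Ioo_mem_nhdsLT hat'] with t ht hta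
    have : D ∩ Icc a t₀ = insert t₀ (D ∩ Icc a t) := by
      ext u
      constructor
      · rintro ⟨hu, hau, hut⟩
        rcases le_or_gt u t with h1 | h1
        · exact Or.inr ⟨hu, hau, h1⟩
        · exact Or.inl (hiso u hu hau (hut.trans htb.le) (by linarith [ht.1]) (by linarith))
      · rintro (rfl | ⟨hu, hau, hut⟩)
        · exact ⟨h0, hat, le_rfl⟩
        · exact ⟨hu, hau, hut.trans ht.2.le⟩
    rw [this, ncard_insert_of_notMem (fun hm => ht.2.not_ge hm.2.2)
      (hD.subset fun u hu => ⟨hu.1, hu.2.1, hu.2.2.trans (ht.2.le.trans htb.le)⟩)]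

section Local

variable {S : Type*} [TopologicalSpace S] {φ : S → E3} {τ : ℝ × ℝ → S}

/-- The surface parametrized by `τ` has a sheet chart near each point of its core. -/
theorem exists_isSheetChart (hφ : Continuous φ) (hτ : Continuous τ)
    (hinj : ∀ s v s' v', |s - s'| < 2 → τ (s, v) = τ (s', v') → s = s' ∧ v = v')
    {p : E3} {k : ℕ} {hk : k ≤ 3} {h : OpenPartialHomeomorph E3 E3} {U : Fin k → Set S}
    (H : IsNormalChart φ p hk h U) {i : Fin k} {t₀ : ℝ} (hi : τ (t₀, 0) ∈ U i) :
    ∃ r, IsSheetChart (φ ∘ τ) t₀ r h (Fin.castLE hk i) ∧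
      ∀ s v, |s - t₀| < r → |v| < r → τ (s, v) ∈ U i := by
  have hev : ∀ᶠ q in 𝓝 (t₀, (0 : ℝ)), τ q ∈ U i :=
    hτ.continuousAt.eventually_mem ((H.isOpen i).mem_nhds hi)
  obtain ⟨η, hη, hev⟩ := Metric.eventually_nhds_iff_ball.mp hev
  have hU : ∀ s v, |s - t₀| < min η 1 → |v| < min η 1 → τ (s, v) ∈ U i := by
    intro s v hs hv
    refine hev _ ?_
    rw [Metric.mem_ball, Prod.dist_eq, max_lt_iff]
    simp only [Real.dist_eq, sub_zero]
    exact ⟨hs.trans_le (min_le_left _ _), hv.trans_le (min_le_left _ _)⟩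
  -- Radius at most `1` keeps any two parameters at distance less than `2`, the range in which `τ`
  -- is injective.
  refine ⟨min η 1, ⟨hφ.comp hτ, by positivity, H.target_eq, ?_, ?_, ?_⟩, hU⟩
  · intro s v hs hv
    exact (H.map_sheet (hU s v hs hv)).1
  · intro s v hs hv
    exact (H.map_sheet (hU s v hs hv)).2
  · intro s v s' v' hs hv hs' hv' he
    refine hinj s v s' v' ?_ (H.injOn_sheet i (hU s v hs hv) (hU s' v' hs' hv') he)
    have h1 := hs.trans_le (min_le_right η 1)
    have h2 := hs'.trans_le (min_le_right η 1)
    rw [abs_lt] at *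
    constructor <;> linarith

/-- Along the core of the annulus, the sided germs form one homotopy class up to a reflection at
each crossing of the singular set. -/
theorem exists_germ_eventually (hφ : Continuous φ) (hτ : Continuous τ)
    (hinj : ∀ s v s' v', |s - s'| < 2 → τ (s, v) = τ (s', v') → s = s' ∧ v = v') {A : Set E3}
    {a b t₀ : ℝ} (hnc : IsNormalCrossingAt φ (φ (τ (t₀, 0))))
    (hA : ∀ᶠ q in 𝓝 (φ (τ (t₀, 0))), IsColouringAt φ A q)
    (htr : τ (t₀, 0) ∈ singularSet φ →
      CrossTransversallyAt (range fun t => τ (t, 0)) (singularSet φ) (τ (t₀, 0)))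
    (htriple : (φ ⁻¹' {φ (τ (t₀, 0))}).encard ≠ 3)
    (ha : τ (a, 0) ∉ singularSet φ) (hat : a ≤ t₀) (htb : t₀ < b)
    (hD : ({t | τ (t, 0) ∈ singularSet φ} ∩ Icc a b).Finite) :
    ∃ f₀, ∀ᶠ t in 𝓝 t₀, τ (t, 0) ∉ singularSet φ →
      (∃ g, IsSidedGerm (range φ) A (φ ∘ τ) t g) ∧
      ∀ g, IsSidedGerm (range φ) A (φ ∘ τ) t g → SphereHomotopic f₀
        (g ∘ sphereReflect^[({t | τ (t, 0) ∈ singularSet φ} ∩ Icc a t).ncard]) := by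
  set D : Set ℝ := {t | τ (t, 0) ∈ singularSet φ} with hDdef
  obtain ⟨k, hk, h, U, H⟩ := hnc.exists_chart
  obtain ⟨i, hi⟩ := H.exists_sheet H.mem_source
  obtain ⟨r, HS, hU⟩ := exists_isSheetChart hφ hτ hinj H hi
  obtain ⟨σ₀, hσ₀, hcol⟩ := H.eventually_colour hA
  have hr := HS.pos
  let c : ℝ → S := fun t => τ (t, 0)
  have hc : Continuous c := hτ.comp (by fun_prop)
  let m : ℝ → ℝ := fun t => otherProd hk i (h (φ (τ (t, 0))))
  have hnear : ∀ᶠ t in 𝓝 t₀, |t - t₀| < r / 2 := by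
    have : Continuous fun t : ℝ => |t - t₀| := by fun_prop
    exact this.continuousAt.eventually_lt continuousAt_const (by simpa using hr)
  have hmem : ∀ t, |t - t₀| < r / 2 → τ (t, 0) ∈ U i := fun t ht =>
    hU t 0 (by linarith) (by simpa using hr)
  have hm0 : ∀ t, |t - t₀| < r / 2 → (t ∈ D ↔ m t = 0) := fun t ht =>
    H.mem_singularSet_iff (hmem t ht)
  have hmc : ContinuousAt m t₀ :=
    (continuous_otherProd hk i).continuousAt.comp
      ((h.continuousAt H.mem_source).comp (f := fun t => φ (τ (t, 0))) (hφ.comp hc).continuousAt)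
  obtain ⟨-, hgt, hlt, hlt'⟩ := eventually_ncard_inter_Icc (D := D) ha hat htb hD
  -- The sign of `σ₀ * m t` tells which side of the sheet is coloured. It changes exactly when the
  -- count of crossings jumps, so after correction by the parity of the count it is a constant `ε`.
  have hsign : ∃ ε : ℝ, (ε = 1 ∨ ε = -1) ∧ ∀ᶠ t in 𝓝 t₀, t ∉ D →
      0 < ε * (-1) ^ (D ∩ Icc a t).ncard * (σ₀ * m t) := by
    have hpw : ∀ n : ℕ, ((-1 : ℝ) ^ n = 1 ∨ (-1 : ℝ) ^ n = -1) := fun n => neg_one_pow_eq_or ℝ n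
    by_cases ht₀ : t₀ ∈ D
    · have hcard : (Finset.univ.erase i).card = 1 := by
        have e1 := H.encard_preimage_centre
        have h1 : 1 < (φ ⁻¹' {φ (τ (t₀, 0))}).encard := ht₀
        rw [e1] at h1 htriple
        have h2 : 1 < k := by exact_mod_cast h1
        have h3 : k ≠ 3 := by
          rintro rfl
          exact htriple rfl
        rw [Finset.card_erase_of_mem (Finset.mem_univ i), Finset.card_univ, Fintype.card_fin]
        omega
      have hcinj : ∀ᶠ δ in 𝓝[>] (0 : ℝ), InjOn c (Icc (t₀ - δ) (t₀ + δ)) := by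
        filter_upwards [Ioo_mem_nhdsGT (one_pos)] with δ hδ s hs s' hs' he
        refine (hinj s 0 s' 0 ?_ he).1
        rw [abs_lt]
        constructor <;> linarith [hs.1, hs.2, hs'.1, hs'.2, hδ.2]
      obtain ⟨s, hs, hpos, hneg⟩ := exists_sign_change_otherProd hφ hc H hi hcard hcinj (htr ht₀)
      refine ⟨s * σ₀ * (-1) ^ (D ∩ Icc a t₀).ncard, ?_, ?_⟩
      · rcases hs with rfl | rfl <;> rcases hσ₀ with rfl | rfl <;>
          rcases hpw (D ∩ Icc a t₀).ncard with e | e <;> rw [e] <;> norm_num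
      · rw [← nhdsNE_sup_pure, eventually_sup, ← nhdsLT_sup_nhdsGT, eventually_sup]
        refine ⟨⟨?_, ?_⟩, ?_⟩
        · filter_upwards [hneg, hlt' ht₀] with t h1 h2 _
          rw [← h2, pow_succ]
          have hσσ : σ₀ * σ₀ = 1 := by rcases hσ₀ with rfl | rfl <;> norm_num
          have hee : ((-1 : ℝ) ^ (D ∩ Icc a t).ncard) * (-1) ^ (D ∩ Icc a t).ncard = 1 := by
            rw [← mul_pow]; norm_num
          have : s * σ₀ * ((-1) ^ (D ∩ Icc a t).ncard * -1) * (-1) ^ (D ∩ Icc a t).ncard *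
              (σ₀ * m t) = -(s * m t) := by
            linear_combination (-(s * m t)) * (σ₀ * σ₀ * hee + hσσ)
          rw [this]
          exact neg_pos.mpr h1
        · filter_upwards [hpos, hgt] with t h1 h2 _
          rw [h2]
          have hσσ : σ₀ * σ₀ = 1 := by rcases hσ₀ with rfl | rfl <;> norm_num
          have hee : ((-1 : ℝ) ^ (D ∩ Icc a t₀).ncard) * (-1) ^ (D ∩ Icc a t₀).ncard = 1 := by
            rw [← mul_pow]; norm_num
          have : s * σ₀ * (-1) ^ (D ∩ Icc a t₀).ncard * (-1) ^ (D ∩ Icc a t₀).ncard *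
              (σ₀ * m t) = s * m t := by
            linear_combination (s * m t) * (σ₀ * σ₀ * hee + hσσ)
          rw [this]
          exact h1
        · rw [eventually_pure]
          exact fun hn => absurd ht₀ hn
    · have hne : m t₀ ≠ 0 := fun h0 => ht₀ ((hm0 t₀ (by simpa using hr)).mpr h0)
      have hN : ∀ᶠ t in 𝓝 t₀, (D ∩ Icc a t).ncard = (D ∩ Icc a t₀).ncard := by
        rw [← nhdsNE_sup_pure, eventually_sup, ← nhdsLT_sup_nhdsGT, eventually_sup]
        exact ⟨⟨hlt ht₀, hgt⟩, by simp⟩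
      have hw : σ₀ * m t₀ ≠ 0 := mul_ne_zero (by rcases hσ₀ with rfl | rfl <;> norm_num) hne
      obtain ⟨e, he, hepos⟩ : ∃ e : ℝ, (e = 1 ∨ e = -1) ∧ 0 < e * (σ₀ * m t₀) := by
        rcases lt_or_gt_of_ne hw with h1 | h1
        · exact ⟨-1, Or.inr rfl, by linarith⟩
        · exact ⟨1, Or.inl rfl, by linarith⟩
      refine ⟨e * (-1) ^ (D ∩ Icc a t₀).ncard, ?_, ?_⟩
      · rcases he with rfl | rfl <;>
          rcases hpw (D ∩ Icc a t₀).ncard with e | e <;> rw [e] <;> norm_num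
      · have hcm : ContinuousAt (fun t => e * (σ₀ * m t)) t₀ :=
          continuousAt_const.mul (continuousAt_const.mul hmc)
        filter_upwards [hN, continuousAt_const.eventually_lt hcm hepos] with t h1 h2 _
        rw [h1]
        have hee : ((-1 : ℝ) ^ (D ∩ Icc a t₀).ncard) * (-1) ^ (D ∩ Icc a t₀).ncard = 1 := by
          rw [← mul_pow]; norm_num
        have : e * (-1) ^ (D ∩ Icc a t₀).ncard * (-1) ^ (D ∩ Icc a t₀).ncard * (σ₀ * m t) =
            e * (σ₀ * m t) := by
          linear_combination (e * (σ₀ * m t)) * hee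
        rw [this]
        exact h2
  obtain ⟨ε, hε, hev⟩ := hsign
  refine ⟨chartGerm (φ ∘ τ) h (Fin.castLE hk i) ε t₀ (r / 4), ?_⟩
  have hcol' := (hφ.comp hc).continuousAt.eventually (eventually_eventually_nhds.mpr hcol)
  filter_upwards [hev, hnear, hcol'] with t h1 h2 h3 hn
  have h1 := h1 hn
  set n := (D ∩ Icc a t).ncard
  set σ : ℝ := ε * (-1) ^ n with hσdef
  have hσ : σ = 1 ∨ σ = -1 := by
    rcases hε with rfl | rfl <;> rcases neg_one_pow_eq_or ℝ n with e | e <;> simp [hσdef, e]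
  have hσ0 : σ ≠ 0 := by rcases hσ with e | e <;> simp [e]
  have hside : HasSide (range φ) A h (Fin.castLE hk i) σ (φ (τ (t, 0))) :=
    H.hasSide i (H.map_sheet (hmem t h2)).1 h3 h1
  refine ⟨HS.exists_isSidedGerm hσ h2 hside, fun g hg => ?_⟩
  have hr4 : 0 < r / 4 := by positivity
  have e1 := HS.sphereHomotopic_of_isSidedGerm hσ h2 hside hg hr4 (by linarith)
  have e2 := e1.trans (HS.sphereHomotopic_chartGerm (t' := t₀) hσ0 h2 (by simpa using hr) hr4 (by linarith)
    hr4 (by linarith))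
  -- Each reflection changes the sign parameter of the chart germ. After as many reflections as
  -- crossings, the parameter is the constant `ε`.
  have hiter : ∀ n : ℕ, SphereHomotopic (g ∘ sphereReflect^[n])
      (chartGerm (φ ∘ τ) h (Fin.castLE hk i) (σ * (-1) ^ n) t₀ (r / 4)) := by
    intro n
    induction n with
    | zero => simpa using e2
    | succ n ih =>
      have := ih.comp_reflect
      rw [← chartGerm_neg] at this
      rw [pow_succ, mul_neg_one, mul_neg]
      exact this
  have hfin := hiter n
  have hee : σ * (-1) ^ n = ε := by
    have : ((-1 : ℝ) ^ n) * (-1) ^ n = 1 := by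
      rw [← mul_pow]; norm_num
    rw [hσdef, mul_assoc, this, mul_one]
  rw [hee] at hfin
  exact hfin.symm

end Local

end SurfaceImmersion

/-! ### Going once around the curve -/

namespace SurfaceImmersion

open Set Filter Topology

variable {S : Type*} [TopologicalSpace S] {φ : S → E3}

/-- Going once around a closed curve with an annular neighbourhood changes the homotopy class of
the sided germs by the parity of the number of crossings with the singular set. -/
theorem even_ncard_of_annulus (hφ : Continuous φ) (hnc : ∀ p, IsNormalCrossingAt φ p)
    {τ : ℝ × ℝ → S} (hτ : Continuous τ) (hτo : IsOpenMap τ)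
    (hinj : ∀ s v s' v', |s - s'| < 2 → τ (s, v) = τ (s', v') → s = s' ∧ v = v') {l : ℝ}
    (hl : 0 < l) (hper : ∀ s v, τ (s + l, v) = τ (s, v)) {A : Set E3}
    (hA : ∀ t, ∀ᶠ q in 𝓝 (φ (τ (t, 0))), IsColouringAt φ A q)
    (htr : ∀ t, τ (t, 0) ∈ singularSet φ →
      CrossTransversallyAt (range fun t => τ (t, 0)) (singularSet φ) (τ (t, 0)))
    (htriple : ∀ t, (φ ⁻¹' {φ (τ (t, 0))}).encard ≠ 3) {a b : ℝ}
    (ha : τ (a, 0) ∉ singularSet φ) (hab : a + l < b)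
    (hD : ({t | τ (t, 0) ∈ singularSet φ} ∩ Icc a b).Finite) :
    Even ({t | τ (t, 0) ∈ singularSet φ} ∩ Icc a (a + l)).ncard := by
  set D : Set ℝ := {t | τ (t, 0) ∈ singularSet φ} with hDdef
  let Good : ℝ → (Metric.sphere (0 : E3) 1 → E3) → Prop := fun t₀ f => ∀ᶠ t in 𝓝 t₀, t ∉ D →
    (∃ g, IsSidedGerm (range φ) A (φ ∘ τ) t g) ∧
    ∀ g, IsSidedGerm (range φ) A (φ ∘ τ) t g →
      SphereHomotopic f (g ∘ sphereReflect^[(D ∩ Icc a t).ncard])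
  have hex : ∀ t ∈ Icc a (a + l), ∃ f, Good t f := fun t ht =>
    exists_germ_eventually hφ hτ hinj (hnc _) (hA t) (htr t) (htriple t) ha ht.1
      (ht.2.trans_lt hab) hD
  -- Parameters just to the right of `t` are not in `D`, and a sided germ at one of them is
  -- homotopic, after the same reflections, to both reference maps.
  have huniq : ∀ t ∈ Icc a (a + l), ∀ f f', Good t f → Good t f' → SphereHomotopic f f' := by
    intro t ht f f' hf hf'
    have h1 := (eventually_ncard_inter_Icc (D := D) ha ht.1 (ht.2.trans_lt hab) hD).1
    obtain ⟨u, hu, huf, huf'⟩ := (h1.and ((hf.and hf').filter_mono nhdsWithin_le_nhds)).exists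
    obtain ⟨g, hg⟩ := (huf hu).1
    exact ((huf hu).2 g hg).trans ((huf' hu).2 g hg).symm
  have hchain : ∀ f f', Good a f → Good (a + l) f' → SphereHomotopic f f' := by
    refine isPreconnected_Icc.induction₂' (s := Icc a (a + l))
      (fun t t' => ∀ f f', Good t f → Good t' f' → SphereHomotopic f f') ?_ ?_
      (left_mem_Icc.mpr (by linarith)) (right_mem_Icc.mpr (by linarith))
    · intro t ht
      obtain ⟨f₀, hf₀⟩ := hex t ht
      filter_upwards [(eventually_eventually_nhds.mpr hf₀).filter_mono nhdsWithin_le_nhds,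
        self_mem_nhdsWithin] with u hu hus
      exact ⟨fun f f' h1 h2 => (huniq t ht f f₀ h1 hf₀).trans (huniq u hus f₀ f' hu h2),
        fun f f' h1 h2 => (huniq u hus f f₀ h1 hu).trans (huniq t ht f₀ f' hf₀ h2)⟩
    · intro t u v _ hu _ h1 h2 f f' hf hf'
      obtain ⟨f₀, hf₀⟩ := hex u hu
      exact (h1 f f₀ hf hf₀).trans (h2 f₀ f' hf₀ hf')
  have hb : a + l ∉ D := by
    rw [hDdef, mem_ofPred_eq, hper]
    exact ha
  obtain ⟨f, hf⟩ := hex a (left_mem_Icc.mpr (by linarith))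
  obtain ⟨f', hf'⟩ := hex (a + l) (right_mem_Icc.mpr (by linarith))
  obtain ⟨⟨g, hg⟩, hfg⟩ := hf.self_of_nhds ha
  -- Here the annulus enters: the parametrization returns to itself with both coordinates
  -- unreversed, so the same germ is sided at both ends.
  have hg' : IsSidedGerm (range φ) A (φ ∘ τ) (a + l) g := by
    obtain ⟨F, ρ, h1, h2, h3, h4, h5, h6, h7⟩ := hg
    refine ⟨F, ρ, h1, h2, fun x hx hx2 => ?_, h4, h5, ?_, ?_⟩
    · rw [h3 x hx hx2, Function.comp_apply, Function.comp_apply, add_right_comm, hper]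
    · simpa only [Function.comp_apply, hper] using h6
    · simpa only [Function.comp_apply, hper] using h7
  have e1 := hfg g hg
  have e2 := (hf'.self_of_nhds hb).2 g hg'
  have hN0 : (D ∩ Icc a a).ncard = 0 := by
    have : D ∩ Icc a a = ∅ := by
      rw [Icc_self]
      ext u
      simp only [mem_inter_iff, mem_singleton_iff, mem_empty_iff_false, iff_false, not_and]
      rintro hu rfl
      exact ha hu
    rw [this, ncard_empty]
  rw [hN0] at e1
  have e3 : SphereHomotopic g (g ∘ sphereReflect^[(D ∩ Icc a (a + l)).ncard]) :=
    e1.symm.trans ((hchain f f' hf hf').trans e2)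
  by_contra hodd
  rw [Nat.not_even_iff_odd] at hodd
  have hinv : Function.Involutive sphereReflect := sphereReflect_sphereReflect
  rw [hinv.iterate_odd hodd] at e3
  -- If the count were odd, `g` would be homotopic to its reflection. Since `g` is homotopic to a
  -- chart germ at `a`, that chart germ would be too, against
  -- `IsSheetChart.not_sphereHomotopic_reflect`.
  obtain ⟨k, hk, h, U, H⟩ := (hnc (φ (τ (a, 0)))).exists_chart
  obtain ⟨i, hi⟩ := H.exists_sheet H.mem_source
  obtain ⟨r, HS, hU⟩ := exists_isSheetChart hφ hτ hinj H hi
  obtain ⟨σ₀, hσ₀, hcol⟩ := H.eventually_colour (hA a)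
  have hr := HS.pos
  have ht : |a - a| < r / 2 := by simpa using hr
  have hw : σ₀ * otherProd hk i (h (φ (τ (a, 0)))) ≠ 0 :=
    mul_ne_zero (by rcases hσ₀ with rfl | rfl <;> norm_num)
      (mt (H.mem_singularSet_iff hi).mpr ha)
  obtain ⟨σ, hσ, hσpos⟩ : ∃ e : ℝ, (e = 1 ∨ e = -1) ∧
      0 < e * (σ₀ * otherProd hk i (h (φ (τ (a, 0))))) := by
    rcases lt_or_gt_of_ne hw with h1 | h1
    · exact ⟨-1, Or.inr rfl, by linarith⟩
    · exact ⟨1, Or.inl rfl, by linarith⟩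
  have e4 := HS.sphereHomotopic_of_isSidedGerm hσ ht (H.hasSide i H.mem_source hcol hσpos) hg
    (ρ := r / 4) (by positivity) (by linarith)
  have e5 := e4.symm.trans (e3.trans e4.comp_reflect)
  refine HS.not_sphereHomotopic_reflect ?_ (ρ := r / 4) (by positivity) (by linarith) ?_
  · intro δ hδ
    have hV : τ '' {q | |q.1 - a| < δ ∧ |q.2| < δ} ∈ 𝓝 (τ (a, 0)) := by
      refine hτo.image_mem_nhds ?_
      refine ((isOpen_lt (f := fun q : ℝ × ℝ => |q.1 - a|) (by fun_prop) continuous_const).inter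
        (isOpen_lt (f := fun q : ℝ × ℝ => |q.2|) (by fun_prop) continuous_const)).mem_nhds ?_
      simpa using hδ
    filter_upwards [H.eventually_exists_mem_sheet hi hV] with q hq h0
    obtain ⟨x, ⟨⟨s, v⟩, ⟨hs, hv⟩, rfl⟩, -, hx⟩ := hq h0
    exact ⟨s, v, hs, hv, hx⟩
  · rcases hσ with rfl | rfl
    · exact e5
    · rw [chartGerm_neg] at e5
      have hcomp : ∀ f : Metric.sphere (0 : E3) 1 → E3, (f ∘ sphereReflect) ∘ sphereReflect = f :=
        fun f => by
          ext1 x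
          simp
      rw [hcomp] at e5
      exact e5.symm

/-- A closed curve with an annular neighbourhood that crosses the singular set of an immersion in
general position transversally, away from the triple points, does so an even number of times. -/
theorem even_ncard_inter_singularSet [CompactSpace S] (hφ : IsGeneralPositionImmersion φ)
    {γ : Circle → S} (hor : IsOrientationPreserving γ)
    (hfin : (range γ ∩ singularSet φ).Finite)
    (htrans : ∀ x ∈ range γ ∩ singularSet φ, CrossTransversallyAt (range γ) (singularSet φ) x)
    (htriple : Disjoint (φ '' range γ) (triplePoints φ)) :
    Even (range γ ∩ singularSet φ).ncard := by
  obtain ⟨e, he, heγ⟩ := hor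
  have hπ := Real.pi_gt_three
  -- The annulus is unrolled to a strip, so that crossings can be counted along an interval of
  -- length `2 * Real.pi`.
  let τ : ℝ × ℝ → S := fun q => e (Circle.exp q.1, q.2)
  have hτγ : ∀ t, τ (t, 0) = γ (Circle.exp t) := fun t => heγ _
  have hτ : Continuous τ := he.continuous.comp (by fun_prop)
  have hτo : IsOpenMap τ :=
    he.isOpenMap.comp (isLocalHomeomorph_circleExp.isOpenMap.prodMap IsOpenMap.id)
  have hexp : ∀ s s' : ℝ, |s - s'| < 2 * Real.pi → Circle.exp s = Circle.exp s' → s = s' := by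
    intro s s' hs h
    rw [abs_lt] at hs
    refine Circle.exp_injOn_of_forall_sub_mem_Ioo (s := {s, s'}) ?_ (by simp) (by simp) h
    rintro x (rfl | rfl) y (rfl | rfl) <;> constructor <;> linarith [hs.1, hs.2]
  have hinj : ∀ s v s' v', |s - s'| < 2 → τ (s, v) = τ (s', v') → s = s' ∧ v = v' := by
    intro s v s' v' hs h
    have := he.injective h
    rw [Prod.mk.injEq] at this
    exact ⟨hexp s s' (by linarith) this.1, this.2⟩
  have hrange : (range fun t => τ (t, 0)) = range γ := by
    ext x
    constructor
    · rintro ⟨t, rfl⟩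
      exact ⟨_, (hτγ t).symm⟩
    · rintro ⟨z, rfl⟩
      obtain ⟨t, rfl⟩ := Circle.exp_surjective z
      exact ⟨t, hτγ t⟩
  have hmem : ∀ t, τ (t, 0) ∈ range γ := fun t => ⟨_, (hτγ t).symm⟩
  have hcl : IsClosed (range φ) := (isCompact_range hφ.continuous).isClosed
  obtain ⟨R, hR⟩ := (isCompact_range hφ.continuous).isBounded.subset_ball (0 : E3)
  obtain ⟨A, hA⟩ := colourable_ball hφ.normalCrossing hcl R
  set D : Set ℝ := {t | τ (t, 0) ∈ singularSet φ} with hDdef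
  -- An interval of length `3 < 2π` is mapped injectively to the curve, so it contains finitely many
  -- crossings. Three such intervals cover more than one turn.
  have hshort : ∀ u : ℝ, (D ∩ Icc u (u + 3)).Finite := by
    intro u
    refine Finite.of_finite_image (f := fun t => τ (t, 0)) (hfin.subset ?_) ?_
    · rintro _ ⟨t, ⟨ht, -⟩, rfl⟩
      exact ⟨hmem t, ht⟩
    · rintro s ⟨-, hs⟩ s' ⟨-, hs'⟩ h
      refine hexp s s' ?_ (Prod.mk.inj (he.injective h)).1
      rw [abs_lt]
      constructor <;> linarith [hs.1, hs.2, hs'.1, hs'.2]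
  have hlong : ∀ u : ℝ, (D ∩ Icc u (u + 9)).Finite := by
    intro u
    refine (((hshort u).union (hshort (u + 3))).union (hshort (u + 6))).subset ?_
    rintro t ⟨ht, h1, h2⟩
    rcases le_or_gt t (u + 3) with h3 | h3
    · exact Or.inl (Or.inl ⟨ht, h1, h3⟩)
    · rcases le_or_gt t (u + 6) with h4 | h4
      · exact Or.inl (Or.inr ⟨ht, h3.le, by linarith⟩)
      · exact Or.inr ⟨ht, h4.le, by linarith⟩
  obtain ⟨a, ha⟩ : ∃ a, a ∉ D := by
    by_contra! h
    refine (Icc_infinite (show (0 : ℝ) < 0 + 3 by norm_num)) ((hshort 0).subset ?_)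
    exact fun t ht => ⟨h t, ht⟩
  have hper : ∀ s v, τ (s + 2 * Real.pi, v) = τ (s, v) := by
    intro s v
    simp only [τ, Circle.exp_add_two_pi]
  have hmain := even_ncard_of_annulus hφ.continuous hφ.normalCrossing hτ hτo hinj
    Real.two_pi_pos hper
    (fun t => eventually_of_mem (Metric.isOpen_ball.mem_nhds (hR (mem_range_self _))) hA)
    (fun t ht => by
      rw [hrange]
      exact htrans _ ⟨hmem t, ht⟩)
    (fun t h3 => disjoint_left.mp htriple (mem_image_of_mem φ (hmem t)) h3)
    ha (show a + 2 * Real.pi < a + 9 by linarith [Real.pi_lt_d2]) (hlong a)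
  have himage : range γ ∩ singularSet φ = (fun t => τ (t, 0)) '' (D ∩ Icc a (a + 2 * Real.pi)) := by
    ext x
    constructor
    · rintro ⟨hx, hxs⟩
      rw [← hrange] at hx
      obtain ⟨t, rfl⟩ := hx
      have hp : Function.Periodic (fun t => τ (t, 0)) (2 * Real.pi) := fun s => hper s 0
      obtain ⟨t', ht', he'⟩ := hp.exists_mem_Ico Real.two_pi_pos t a
      refine ⟨t', ⟨?_, Ico_subset_Icc_self ht'⟩, he'.symm⟩
      have he'' : τ (t, 0) = τ (t', 0) := he'
      rw [hDdef, mem_ofPred_eq, ← he'']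
      exact hxs
    · rintro ⟨t, ⟨ht, -⟩, rfl⟩
      exact ⟨hmem t, ht⟩
  -- The two ends of the closed interval give the same point of the curve, but it is not singular,
  -- so no crossing is counted twice.
  have hlast : InjOn (fun t => τ (t, 0)) (D ∩ Icc a (a + 2 * Real.pi)) := by
    have hlt : ∀ t ∈ D ∩ Icc a (a + 2 * Real.pi), a < t ∧ t < a + 2 * Real.pi := by
      rintro t ⟨ht, h1, h2⟩
      refine ⟨lt_of_le_of_ne h1 ?_, lt_of_le_of_ne h2 ?_⟩
      · rintro rfl
        exact ha ht
      · rintro rfl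
        rw [hDdef, mem_ofPred_eq, hper] at ht
        exact ha ht
    intro s hs s' hs' h
    have h1 := hlt s hs
    have h2 := hlt s' hs'
    refine hexp s s' ?_ (Prod.mk.inj (he.injective h)).1
    rw [abs_lt]
    constructor <;> linarith
  rw [himage, hlast.ncard_image]
  exact hmain

end SurfaceImmersion

theorem lemma2 {S : Type*} [TopologicalSpace S] [T2Space S] [CompactSpace S]
    [ChartedSpace SurfaceImmersion.E2 S]
    (φ : S → SurfaceImmersion.E3) (hφ : SurfaceImmersion.IsGeneralPositionImmersion φ)
    (γ : Circle → S) (hγ : Topology.IsEmbedding γ)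
    (hor : SurfaceImmersion.IsOrientationPreserving γ)
    (hfin : (Set.range γ ∩ SurfaceImmersion.singularSet φ).Finite)
    (htrans : ∀ x ∈ Set.range γ ∩ SurfaceImmersion.singularSet φ,
      SurfaceImmersion.CrossTransversallyAt (Set.range γ) (SurfaceImmersion.singularSet φ) x)
    (htriple : Disjoint (φ '' Set.range γ) (SurfaceImmersion.triplePoints φ)) :
    Even (Set.range γ ∩ SurfaceImmersion.singularSet φ).ncard :=
  SurfaceImmersion.even_ncard_inter_singularSet hφ hor hfin htrans htriple
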